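/- Let $(\mathcal S,\mathcal A,P,\rho,\gamma,r_{1:m})$ be an MDP with finite state and action spaces, transition kernel $P$, initial distribution $\rho$, discount factor $\gamma\in(0,1)$ and $m$ reward functions $r_i:\mathcal S\times\mathcal A\to[0,1]$. For a stationary policy $\pi$ and $r:\mathcal S\times\mathcal A\to\mathbb R$ let $V_r^\pi(\rho)=\mathbb E_{s_0\sim\rho}\big[\sum_{t\ge0}\gamma^t r(s_t,a_t)\mid\pi\big]$ and $V^\pi=(V^\pi_{r_1}(\rho),\dots,V^\pi_{r_m}(\rho))\in\mathbb R^m$; let $d^\pi_\rho(s,a)=(1-\gamma)\sum_{t\ge0}\gamma^t\,\mathbb P_{s_0\sim\rho}(s_t=s,a_t=a\mid\pi)$ and $d^\pi_\rho(s)=\sum_a d^\pi_\rho(s,a)$; let $\mathcal V$ be the set of all $V^\pi$. Let $\pi_\theta(a|s)=e^{\theta_{s,a}}/\sum_{a'}e^{\theta_{s,a'}}$, $\theta\in\mathbb R^{\mathcal S\times\mathcal A}$, be the softmax policies and $D(x\|y)=\sum_i x_i\log(x_i/y_i)$ the KL divergence. Let $\Lambda$ be a nonempty closed convex subset of the probability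 simplex $\Delta([m])$, and let $\Phi:\mathbb R^m\times\mathbb R^m\to\mathbb R$ be such that $\Phi(\cdot,\lambda)$ is concave on $\mathcal V$ for every $\lambda\in\Lambda$, $\Phi(v,\cdot)$ is convex on $\Lambda$ for every $v\in\mathcal V$, and $\Phi$ is $\beta$-smooth ($\beta>0$) with respect to the norm $\|v\|_\infty+\|\lambda\|_1$ on $\mathcal V\times\Delta([m])$, i.e. the partial gradients exist there and $$\|\nabla_v\Phi(v,\lambda)-\nabla_v\Phi(v',\lambda')\|_1+\|\nabla_\lambda\Phi(v,\lambda)-\nabla_\lambda\Phi(v',\lambda')\|_\infty\le\beta\big(\|v-v'\|_\infty+\|\lambda-\lambda'\|_1\big).$$ Put $F(v)=\min_{\lambda\in\Lambda}\Phi(v,\lambda)$. $\mathrm{InnerLoop}(\bar\theta,\tilde r,\alpha,\eta,t)$ starts from $\theta^{(0)}=\bar\theta$, performs $t$ natural policy gradient steps $$\theta^{(j+1)}=\theta^{(j)}+\eta\,\mathcal F_\rho(\theta^{(j)})^\dagger\,\nabla_\theta\Big[V^{\pi_\theta}_{\tilde r}(\rho)-\frac{\alpha}{1-\gamma}\sum_s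 d^{\pi_\theta}_\rho(s)\,D\big(\pi_\theta(\cdot|s)\,\|\,\pi_{\bar\theta}(\cdot|s)\big)\Big]_{\theta=\theta^{(j)}},$$ and returns $\theta^{(t)}$; here $\mathcal F_\rho(\theta)=\mathbb E_{(s,a)\sim d^{\pi_\theta}_\rho}[\nabla_\theta\log\pi_\theta(a|s)\,\nabla_\theta\log\pi_\theta(a|s)^{\top}]$ and $\dagger$ is the Moore--Penrose inverse. ARNPG-OMDA maintains policies $\pi_k=\pi_{\theta_k}$, $\tilde\pi_k=\pi_{\tilde\theta_k}$ and vectors $\lambda_k,\tilde\lambda_k$. It starts with $\tilde\theta_0=\theta_0$ such that $\pi_0$ is the uniform policy, and with $\lambda_0=\tilde\lambda_0$ uniform on $[m]$. With $\tilde G^v_k=\nabla_v\Phi(V^{\tilde\pi_k},\tilde\lambda_k)$, $\tilde G^\lambda_k=\nabla_\lambda\Phi(V^{\tilde\pi_k},\tilde\lambda_k)$ and $\tilde r_k(s,a)=\langle\tilde G^v_k,r_{1:m}(s,a)\rangle$, it performs for $k=0,\dots,K-1$ $$\tilde\theta_{k+1}=\mathrm{InnerLoop}(\theta_k,\tilde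 r_k,\alpha,\eta,t_k),\qquad \tilde\lambda_{k+1}\in\arg\min_{\lambda\in\Lambda}\Big\{\langle\tilde G^\lambda_k,\lambda\rangle+\tfrac{1}{\eta'}D(\lambda\|\lambda_k)\Big\},$$ $$\theta_{k+1}=\mathrm{InnerLoop}(\theta_k,\tilde r_{k+1},\alpha,\eta,t_k),\qquad \lambda_{k+1}\in\arg\min_{\lambda\in\Lambda}\Big\{\langle\tilde G^\lambda_{k+1},\lambda\rangle+\tfrac{1}{\eta'}D(\lambda\|\lambda_k)\Big\}.$$ **Theorem.** Let $K\ge1$, $0<\eta'\le\frac1{6\beta}$, $\alpha\ge\frac{6\beta}{(1-\gamma)^3}$, $\eta=\frac{1-\gamma}{\alpha}$, let $L>0$ satisfy $\|\tilde G^v_k\|_1\le L$ for $0\le k\le K$, and let $$t_k=\Big\lceil\frac1{1-\gamma}\log\Big(\frac{5LK}{6\beta\log|\mathcal A|}\Big)+1\Big\rceil$$ (no inner iteration is made if this number is not positive; if $|\mathcal A|=1$ there is only one policy and $t_k$ plays no role). Then for every stationary policy $\pi^*$, in particular for an optimal policy of $\max_\pi\min_{\lambda\in\Lambda}\Phi(V^\pi,\lambda)$,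 $$F(V^{\pi^*})-F\Big(\frac1K\sum_{k=1}^K V^{\tilde\pi_k}\Big)\le\frac{3\alpha\log|\mathcal A|}{(1-\gamma)K}+\frac{\log m}{\eta'K}.$$ -/

import Mathlib

noncomputable section

/-- The gradient `∇ f x`, as the vector of partial derivatives. -/
def grad {ι : Type*} [Fintype ι] [DecidableEq ι] (f : (ι → ℝ) → ℝ) (x : ι → ℝ) : ι → ℝ :=
  fun i => fderiv ℝ f x (Pi.single i 1)

/-- The `ℓ¹`-norm. (The `ℓ^∞`-norm of `x : ι → ℝ` is Mathlib's `‖x‖`.) -/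
def l1norm {ι : Type*} [Fintype ι] (x : ι → ℝ) : ℝ := ∑ i, |x i|

/-- `D(x ‖ y) = ∑ i, x i * log (x i / y i)`, with `0 * log 0 = 0`. This is the Kullback-Leibler
divergence when `DomBy x y` holds; otherwise the divergence is `+∞`. -/
def klVec {ι : Type*} [Fintype ι] (x y : ι → ℝ) : ℝ := ∑ i, x i * Real.log (x i / y i)

/-- `x` vanishes wherever `y` does, i.e. `D(x ‖ y) < ∞`. -/
def DomBy {ι : Type*} (x y : ι → ℝ) : Prop := ∀ i, y i = 0 → x i = 0

/-- The four Penrose conditions for a real square matrix. -/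
structure IsMoorePenrose {ι : Type*} [Fintype ι] (A B : Matrix ι ι ℝ) : Prop where
  mul_mul_left : A * B * A = A
  mul_mul_right : B * A * B = B
  symm_left : (A * B).transpose = A * B
  symm_right : (B * A).transpose = B * A

theorem exists_isMoorePenrose {ι : Type*} [Fintype ι] [DecidableEq ι] (A : Matrix ι ι ℝ)
    (hA : A.transpose = A) : ∃ B, IsMoorePenrose A B := by
  have hH : A.IsHermitian := by
    simpa [Matrix.IsHermitian, Matrix.conjTranspose_eq_transpose_of_trivial] using hA
  obtain ⟨U, d, hU, hAU⟩ : ∃ (U : Matrix ι ι ℝ) (d : ι → ℝ), U.transpose * U = 1 ∧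
      A = U * Matrix.diagonal d * U.transpose := by
    refine ⟨hH.eigenvectorUnitary, hH.eigenvalues, ?_, ?_⟩
    · have := Unitary.coe_star_mul_self hH.eigenvectorUnitary
      simpa [Matrix.star_eq_conjTranspose, Matrix.conjTranspose_eq_transpose_of_trivial] using this
    · have h := hH.spectral_theorem
      rw [Unitary.conjStarAlgAut_apply] at h
      simpa [Matrix.star_eq_conjTranspose, Matrix.conjTranspose_eq_transpose_of_trivial,
        Function.comp_def] using h
  have key : ∀ a b : ι → ℝ, (U * Matrix.diagonal a * U.transpose) *
      (U * Matrix.diagonal b * U.transpose) =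
      U * Matrix.diagonal (fun i => a i * b i) * U.transpose := by
    intro a b
    calc _ = U * Matrix.diagonal a * (U.transpose * U) * Matrix.diagonal b * U.transpose := by
          simp only [Matrix.mul_assoc]
      _ = _ := by
          rw [hU, Matrix.mul_one, Matrix.mul_assoc U, Matrix.diagonal_mul_diagonal]
  have tr : ∀ a : ι → ℝ, (U * Matrix.diagonal a * U.transpose).transpose =
      U * Matrix.diagonal a * U.transpose := by
    intro a
    simp [Matrix.transpose_mul, Matrix.mul_assoc]
  refine ⟨U * Matrix.diagonal (fun i => (d i)⁻¹) * U.transpose, ?_, ?_, ?_, ?_⟩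
  · rw [hAU, key, key]; simp [mul_inv_mul_cancel]
  · rw [hAU, key, key]; congr 3; funext i
    by_cases h : d i = 0 <;> simp [h]
  · rw [hAU, key, tr]
  · rw [hAU, key, tr]

open Classical in
/-- The Moore-Penrose inverse; it satisfies the Penrose conditions for every symmetric matrix. -/
def pinv {ι : Type*} [Fintype ι] (A : Matrix ι ι ℝ) : Matrix ι ι ℝ :=
  if h : ∃ B, IsMoorePenrose A B then h.choose else 0

theorem pinv_spec {ι : Type*} [Fintype ι] [DecidableEq ι] (A : Matrix ι ι ℝ)
    (hA : A.transpose = A) : IsMoorePenrose A (pinv A) := by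
  have h := exists_isMoorePenrose A hA
  rw [pinv, dif_pos h]
  exact h.choose_spec

/-- A finite discounted Markov decision process with `m` reward functions valued in `[0, 1]`. -/
structure MOMDP (S A : Type*) [Fintype S] [Fintype A] (m : ℕ) where
  /-- transition kernel: `P s a s'` is the probability of moving to `s'` -/
  P : S → A → S → ℝ
  P_mem : ∀ s a, P s a ∈ stdSimplex ℝ S
  /-- initial state distribution -/
  ρ : S → ℝ
  ρ_mem : ρ ∈ stdSimplex ℝ S
  /-- discount factor -/
  γ : ℝ
  γ_pos : 0 < γ
  γ_lt_one : γ < 1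
  /-- reward functions -/
  r : Fin m → S → A → ℝ
  r_mem : ∀ i s a, r i s a ∈ Set.Icc (0 : ℝ) 1

/-- Stationary randomized policies. -/
def IsPolicy {S A : Type*} [Fintype A] (π : S → A → ℝ) : Prop := ∀ s, π s ∈ stdSimplex ℝ A

/-- The softmax policy `π_θ(a|s) = exp θ_{s,a} / ∑ a', exp θ_{s,a'}`. -/
def softmax {S A : Type*} [Fintype A] (θ : S × A → ℝ) (s : S) (a : A) : ℝ :=
  Real.exp (θ (s, a)) / ∑ a', Real.exp (θ (s, a'))

namespace MOMDP

variable {S A : Type*} [Fintype S] [Fintype A] [DecidableEq S] [DecidableEq A] {m : ℕ}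

/-- `stateProb π s₀ t s = ℙ(s_t = s | s₀, π)`. -/
def stateProb (M : MOMDP S A m) (π : S → A → ℝ) (s₀ : S) : ℕ → S → ℝ
  | 0 => Pi.single s₀ 1
  | t + 1 => fun s' => ∑ s, ∑ a, M.stateProb π s₀ t s * π s a * M.P s a s'

/-- `V_r^π(s₀) = 𝔼[∑ t, γ^t r(s_t, a_t) | s₀, π]`. -/
def stateValue (M : MOMDP S A m) (r : S → A → ℝ) (π : S → A → ℝ) (s₀ : S) : ℝ :=
  ∑' t : ℕ, M.γ ^ t * ∑ s, ∑ a, M.stateProb π s₀ t s * π s a * r s a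

/-- `V_r^π(ρ) = 𝔼_{s₀ ∼ ρ}[V_r^π(s₀)]`. -/
def value (M : MOMDP S A m) (r : S → A → ℝ) (π : S → A → ℝ) : ℝ :=
  ∑ s₀, M.ρ s₀ * M.stateValue r π s₀

/-- The value vector `V_{1:m}^π(ρ)`. -/
def valueVec (M : MOMDP S A m) (π : S → A → ℝ) : Fin m → ℝ := fun i => M.value (M.r i) π

/-- The value vectors of all stationary policies. -/
def valueSet (M : MOMDP S A m) : Set (Fin m → ℝ) := {v | ∃ π, IsPolicy π ∧ M.valueVec π = v}

/-- The discounted state-action visitation distribution `d_ρ^π(s, a)`. -/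
def visit (M : MOMDP S A m) (π : S → A → ℝ) (s : S) (a : A) : ℝ :=
  (1 - M.γ) * ∑ s₀, M.ρ s₀ * ∑' t : ℕ, M.γ ^ t * (M.stateProb π s₀ t s * π s a)

/-- The state visitation distribution `d_ρ^π(s)`. -/
def stateVisit (M : MOMDP S A m) (π : S → A → ℝ) (s : S) : ℝ := ∑ a, M.visit π s a

/-- The KL-regularized value
`V_r^{π_θ}(ρ) - α D_{d_ρ^{π_θ}}(π_θ ‖ π_{θ₀}) / (1 - γ)` with anchor `π_{θ₀}`. -/
def regValue (M : MOMDP S A m) (r : S → A → ℝ) (α : ℝ) (θ₀ θ : S × A → ℝ) : ℝ :=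
  M.value r (softmax θ) -
    α * (∑ s, M.stateVisit (softmax θ) s * klVec (softmax θ s) (softmax θ₀ s)) / (1 - M.γ)

/-- The Fisher information matrix
`𝔼_{(s,a) ∼ d_ρ^{π_θ}}[∇ log π_θ(a|s) (∇ log π_θ(a|s))ᵀ]`. -/
def fisher (M : MOMDP S A m) (θ : S × A → ℝ) : Matrix (S × A) (S × A) ℝ :=
  ∑ s, ∑ a, M.visit (softmax θ) s a •
    Matrix.vecMulVec (grad (fun θ' => Real.log (softmax θ' s a)) θ)
      (grad (fun θ' => Real.log (softmax θ' s a)) θ)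

theorem fisher_transpose (M : MOMDP S A m) (θ : S × A → ℝ) :
    (M.fisher θ).transpose = M.fisher θ := by
  ext i j
  simp [fisher, Matrix.sum_apply, Matrix.vecMulVec_apply, mul_comm]

/-- The result of `t` natural policy gradient steps with step size `η` on the value with reward
`r`, regularized towards the anchor `π_{θ₀}`, started at `θ₀`. -/
def innerLoop (M : MOMDP S A m) (θ₀ : S × A → ℝ) (r : S → A → ℝ) (α η : ℝ) : ℕ → S × A → ℝ
  | 0 => θ₀
  | t + 1 => M.innerLoop θ₀ r α η t +
      η • (pinv (M.fisher (M.innerLoop θ₀ r α η t))).mulVec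
        (grad (M.regValue r α θ₀) (M.innerLoop θ₀ r α η t))

/-- The scalarized reward `⟨G, r_{1:m}(s, a)⟩`. -/
def dirReward (M : MOMDP S A m) (G : Fin m → ℝ) (s : S) (a : A) : ℝ := ∑ i, G i * M.r i s a

end MOMDP

section MaxMin

variable {m : ℕ}

/-- `∇_v Φ(v, lam)`. -/
def gradV (Φ : (Fin m → ℝ) → (Fin m → ℝ) → ℝ) (v lam : Fin m → ℝ) : Fin m → ℝ :=
  grad (fun w => Φ w lam) v

/-- `∇_λ Φ(v, lam)`. -/
def gradLam (Φ : (Fin m → ℝ) → (Fin m → ℝ) → ℝ) (v lam : Fin m → ℝ) : Fin m → ℝ :=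
  grad (fun μ => Φ v μ) lam

/-- `F(v) = min_{lam ∈ Λ} Φ(v, lam)`. -/
def minValue (Φ : (Fin m → ℝ) → (Fin m → ℝ) → ℝ) (Λ : Set (Fin m → ℝ)) (v : Fin m → ℝ) : ℝ :=
  sInf (Φ v '' Λ)

/-- `Φ` has partial gradients on `V × Δ([m])`, and
`(∇_v Φ, -∇_λ Φ)` is `β`-Lipschitz there from the norm `‖v‖_∞ + ‖lam‖₁` to its dual norm. -/
structure IsSmoothOn (Φ : (Fin m → ℝ) → (Fin m → ℝ) → ℝ) (V : Set (Fin m → ℝ)) (β : ℝ) :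
    Prop where
  diff_left : ∀ v ∈ V, ∀ lam ∈ stdSimplex ℝ (Fin m), DifferentiableAt ℝ (fun w => Φ w lam) v
  diff_right : ∀ v ∈ V, ∀ lam ∈ stdSimplex ℝ (Fin m), DifferentiableAt ℝ (fun μ => Φ v μ) lam
  lipschitz : ∀ v ∈ V, ∀ lam ∈ stdSimplex ℝ (Fin m), ∀ v' ∈ V, ∀ lam' ∈ stdSimplex ℝ (Fin m),
    l1norm (gradV Φ v lam - gradV Φ v' lam') + ‖gradLam Φ v lam - gradLam Φ v' lam'‖ ≤
      β * (‖v - v'‖ + l1norm (lam - lam'))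

/-- `lam' ∈ argmin_{μ ∈ Λ} {⟨G, μ⟩ + D(μ ‖ lam) / η'}`, where `D(μ ‖ lam) = +∞` unless
`DomBy μ lam`. -/
structure IsMirrorStep (Λ : Set (Fin m → ℝ)) (G : Fin m → ℝ) (η' : ℝ) (lam lam' : Fin m → ℝ) :
    Prop where
  mem : lam' ∈ Λ
  domBy : DomBy lam' lam
  le : ∀ μ ∈ Λ, DomBy μ lam →
    G ⬝ᵥ lam' + klVec lam' lam / η' ≤ G ⬝ᵥ μ + klVec μ lam / η'

variable {S A : Type*} [Fintype S] [Fintype A] [DecidableEq S] [DecidableEq A]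

/-- The sequences `θ k`, `θ' k` (parameters of `π_k` and `π̃_k`) and `lam k`, `lam' k`
(`λ_k` and `λ̃_k`) form a run of ARNPG-OMDA with `K` macro steps and `t k` inner iterations in
macro step `k`. -/
structure IsOMDARun (M : MOMDP S A m) (Φ : (Fin m → ℝ) → (Fin m → ℝ) → ℝ)
    (Λ : Set (Fin m → ℝ)) (α η η' : ℝ) (K : ℕ) (t : ℕ → ℕ)
    (θ θ' : ℕ → S × A → ℝ) (lam lam' : ℕ → Fin m → ℝ) : Prop where
  init_uniform : ∀ s a, softmax (θ 0) s a = 1 / (Fintype.card A : ℝ)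
  init_policy : θ' 0 = θ 0
  init_lam : lam 0 = fun _ => 1 / (m : ℝ)
  init_lam' : lam' 0 = fun _ => 1 / (m : ℝ)
  step_policy' : ∀ k < K, θ' (k + 1) =
    M.innerLoop (θ k) (M.dirReward (gradV Φ (M.valueVec (softmax (θ' k))) (lam' k))) α η (t k)
  step_lam' : ∀ k < K,
    IsMirrorStep Λ (gradLam Φ (M.valueVec (softmax (θ' k))) (lam' k)) η' (lam k) (lam' (k + 1))
  step_policy : ∀ k < K, θ (k + 1) =
    M.innerLoop (θ k)
      (M.dirReward (gradV Φ (M.valueVec (softmax (θ' (k + 1)))) (lam' (k + 1)))) α η (t k)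
  step_lam : ∀ k < K,
    IsMirrorStep Λ (gradLam Φ (M.valueVec (softmax (θ' (k + 1)))) (lam' (k + 1))) η'
      (lam k) (lam (k + 1))

end MaxMin

end

set_option linter.unusedSectionVars false

/-! ### Kullback-Leibler divergence on finite types -/

section KL

variable {ι : Type*} [Fintype ι]

/-! The run is optimistic mirror descent ascent for the saddle function `Φ`. For the `lam`-player
the mirror geometry is the KL divergence. For the policy player it is `α / (1 - γ)` times the KL
divergence between action distributions, averaged over states with the visitation distribution of
the first policy.

The policy player fits this scheme because a natural policy gradient step of size `(1 - γ) / α` is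
exactly a step of soft policy iteration towards the anchor (`MOMDP.npg_step_of_visited`): the
gradient is the Fisher matrix applied to the scaled advantage, and state-dependent shifts do not
change a softmax policy. Soft policy iteration is monotone and contracts by `γ`, so the inner loop
satisfies the mirror-descent three-point inequality up to a geometrically small error
(`MOMDP.three_point`). The prescribed number of iterations brings this error below `α log|A| / ((1 -
γ) K)`.

In a macro step, the three-point inequality of the final update against an arbitrary comparator is
added to that of the predictor update against the final iterate. What remains is the change of
gradient paired with the distance between predictor and final iterate, minus KL terms. Smoothness
bounds the first. Pinsker's inequality (`sq_l1norm_sub_le`) and the performance difference identity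
(`MOMDP.value_sub_baseline`) show that the KL terms dominate `3β` times squared distances, which
absorb it up to a telescoping difference (`optimistic_step_le`).

The initial potential is at most `α log|A| / (1 - γ) + log m / η'` because the start is uniform. The
two inner loops of each macro step contribute `2 α log|A| / (1 - γ)` in total, hence the factor 3.
Linearising the concave-convex `Φ` and averaging turns regret into the max-min gap. -/

theorem pade_le_log {x : ℝ} (hx : 0 < x) :
    (x - 1) * (5 * x + 1) / (2 * x * (x + 2)) ≤ Real.log x := by
  -- The rational function is a Padé-type approximant of `log` at 1: the derivative of the
  -- difference is a positive multiple of `(y - 1) ^ 3`, so the difference has its minimum, 0, at 1.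
  set g : ℝ → ℝ := fun y => Real.log y - (5 * y ^ 2 - 4 * y - 1) / (2 * y ^ 2 + 4 * y) with hg
  have hd : ∀ y : ℝ, 0 < y → HasDerivAt g ((y - 1) ^ 3 / (y ^ 2 * (y + 2) ^ 2)) y := by
    intro y hy
    have h1 := Real.hasDerivAt_log hy.ne'
    have hN : HasDerivAt (fun y : ℝ => 5 * y ^ 2 - 4 * y - 1) (10 * y - 4) y := by
      have := (((hasDerivAt_id y).pow 2).const_mul 5).sub ((hasDerivAt_id y).const_mul 4)
        |>.sub_const 1
      refine this.congr_deriv ?_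
      simp; ring
    have hD : HasDerivAt (fun y : ℝ => 2 * y ^ 2 + 4 * y) (4 * y + 4) y := by
      have := (((hasDerivAt_id y).pow 2).const_mul 2).add ((hasDerivAt_id y).const_mul 4)
      refine this.congr_deriv ?_
      simp; ring
    have hD0 : 2 * y ^ 2 + 4 * y ≠ 0 := by positivity
    refine (h1.sub (hN.div hD hD0)).congr_deriv ?_
    field_simp
    ring
  have hg1 : g 1 = 0 := by simp [hg]; norm_num
  have hcont : ContinuousOn g (Set.Ioi 0) := fun y hy =>
    (hd y hy).continuousAt.continuousWithinAt
  have hnn : 0 ≤ g x := by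
    rw [← hg1]
    rcases le_total x 1 with h | h
    · have : AntitoneOn g (Set.Icc x 1) := by
        refine antitoneOn_of_deriv_nonpos (convex_Icc _ _)
          (hcont.mono fun y hy => hx.trans_le hy.1) ?_ ?_
        · intro y hy
          rw [interior_Icc] at hy
          exact (hd y (hx.trans hy.1)).differentiableAt.differentiableWithinAt
        · intro y hy
          rw [interior_Icc] at hy
          rw [(hd y (hx.trans hy.1)).deriv]
          refine div_nonpos_of_nonpos_of_nonneg ?_ (by positivity)
          have : y - 1 ≤ 0 := by linarith [hy.2]
          exact Odd.pow_nonpos (by decide) this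
      exact this ⟨le_rfl, h⟩ ⟨h, le_rfl⟩ h
    · have : MonotoneOn g (Set.Icc 1 x) := by
        refine monotoneOn_of_deriv_nonneg (convex_Icc _ _)
          (hcont.mono fun y hy => one_pos.trans_le hy.1) ?_ ?_
        · intro y hy
          rw [interior_Icc] at hy
          exact (hd y (one_pos.trans hy.1)).differentiableAt.differentiableWithinAt
        · intro y hy
          rw [interior_Icc] at hy
          rw [(hd y (one_pos.trans hy.1)).deriv]
          have : 0 ≤ y - 1 := by linarith [hy.1]
          positivity
      exact this ⟨le_rfl, h⟩ ⟨h, le_rfl⟩ h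
  have e : (x - 1) * (5 * x + 1) / (2 * x * (x + 2)) =
      (5 * x ^ 2 - 4 * x - 1) / (2 * x ^ 2 + 4 * x) := by
    congr 1 <;> ring
  rw [e]
  simpa [hg] using hnn

/-- A termwise form of Pinsker's inequality. The weights `(2p + 4q) / 3` sum to 2 over two
probability vectors, so Cauchy-Schwarz then gives the sharp constant. -/
theorem sq_sub_le_kl_term {p q : ℝ} (hp : 0 ≤ p) (hq : 0 < q) :
    (p - q) ^ 2 ≤ ((2 * p + 4 * q) / 3) * (p * Real.log (p / q) - p + q) := by
  rcases hp.eq_or_lt with rfl | hp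
  · simp; nlinarith
  · have h := pade_le_log (div_pos hp hq)
    have e : (p / q - 1) * (5 * (p / q) + 1) / (2 * (p / q) * (p / q + 2)) =
        (p - q) * (5 * p + q) / (2 * p * (p + 2 * q)) := by
      field_simp
    rw [e, div_le_iff₀ (by positivity)] at h
    nlinarith

theorem klVec_nonneg {x y : ι → ℝ} (hx : x ∈ stdSimplex ℝ ι) (hy : y ∈ stdSimplex ℝ ι)
    (h : DomBy x y) : 0 ≤ klVec x y := by
  have : ∑ i, (x i - y i) ≤ klVec x y := by
    refine Finset.sum_le_sum fun i _ => ?_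
    rcases (hx.1 i).eq_or_lt with h0 | h0
    · rw [← h0]; simpa using hy.1 i
    · have hy0 : 0 < y i := lt_of_le_of_ne (hy.1 i) fun e => h0.ne' (h i e.symm)
      have := Real.one_sub_inv_le_log_of_pos (div_pos h0 hy0)
      have h2 := mul_le_mul_of_nonneg_left this h0.le
      have e : x i * (1 - (x i / y i)⁻¹) = x i - y i := by field_simp
      linarith
  rw [Finset.sum_sub_distrib, hx.2, hy.2] at this
  linarith

/-- **Pinsker's inequality.** -/
theorem sq_l1norm_sub_le {x y : ι → ℝ} (hx : x ∈ stdSimplex ℝ ι) (hy : y ∈ stdSimplex ℝ ι)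
    (h : DomBy x y) : l1norm (x - y) ^ 2 ≤ 2 * klVec x y := by
  have key : ∀ i, |(x - y) i| ^ 2 ≤
      ((2 * x i + 4 * y i) / 3) * (x i * Real.log (x i / y i) - x i + y i) ∧
      0 ≤ x i * Real.log (x i / y i) - x i + y i := by
    intro i
    rcases (hy.1 i).eq_or_lt with h0 | h0
    · simp [← h0, h i h0.symm]
    · have h1 := sq_sub_le_kl_term (hx.1 i) h0
      refine ⟨by simpa [sq_abs] using h1, ?_⟩
      have hpos : 0 < (2 * x i + 4 * y i) / 3 := by have := hx.1 i; positivity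
      exact nonneg_of_mul_nonneg_right ((sq_nonneg _).trans h1) hpos
  have := Finset.sum_sq_le_sum_mul_sum_of_sq_le_mul Finset.univ
    (r := fun i => |(x - y) i|) (f := fun i => (2 * x i + 4 * y i) / 3)
    (g := fun i => x i * Real.log (x i / y i) - x i + y i)
    (fun i _ => by have := hx.1 i; have := hy.1 i; positivity) (fun i _ => (key i).2)
    (fun i _ => (key i).1)
  have e1 : ∑ i, (2 * x i + 4 * y i) / 3 = 2 := by
    rw [← Finset.sum_div, Finset.sum_add_distrib, ← Finset.mul_sum, ← Finset.mul_sum, hx.2, hy.2]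
    norm_num
  have e2 : ∑ i, (x i * Real.log (x i / y i) - x i + y i) = klVec x y := by
    rw [Finset.sum_add_distrib, Finset.sum_sub_distrib, hx.2, hy.2, klVec]; ring
  rw [e1, e2] at this
  exact this

theorem klVec_uniform_le {x : ι → ℝ} (hx : x ∈ stdSimplex ℝ ι) :
    klVec x (fun _ => 1 / (Fintype.card ι : ℝ)) ≤ Real.log (Fintype.card ι) := by
  have : klVec x (fun _ => 1 / (Fintype.card ι : ℝ)) ≤
      ∑ i, x i * Real.log (Fintype.card ι) := by
    refine Finset.sum_le_sum fun i _ => mul_le_mul_of_nonneg_left ?_ (hx.1 i)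
    have hc : (0 : ℝ) < Fintype.card ι := by
      exact_mod_cast Fintype.card_pos_iff.mpr ⟨i⟩
    rcases (hx.1 i).eq_or_lt with h0 | h0
    · rw [← h0]
      simpa using Real.log_natCast_nonneg _
    · refine Real.log_le_log (by positivity) ?_
      have : x i ≤ 1 := hx.2 ▸ Finset.single_le_sum (fun j _ => hx.1 j) (Finset.mem_univ i)
      rw [div_div_eq_mul_div, div_one]
      nlinarith
  rwa [← Finset.sum_mul, hx.2, one_mul] at this

/-- The first-order inequality for `x ↦ x * log (x / c)`. -/
theorem mul_log_div_sub_le {c y z : ℝ} (hc : 0 < c) (hy : 0 ≤ y) (hz : 0 < z) :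
    z * Real.log (z / c) - y * Real.log (y / c) ≤ (z - y) * (Real.log (z / c) + 1) := by
  rcases hy.eq_or_lt with rfl | hy
  · simp; nlinarith
  · have h := Real.log_le_sub_one_of_pos (div_pos hz hy)
    have e : Real.log (z / y) = Real.log (z / c) - Real.log (y / c) := by
      rw [Real.log_div hz.ne' hy.ne', Real.log_div hz.ne' hc.ne', Real.log_div hy.ne' hc.ne']
      ring
    have h2 := mul_le_mul_of_nonneg_left h hy.le
    have e2 : y * (z / y - 1) = z - y := by field_simp
    rw [e, e2] at h2
    nlinarith

end KL

/-! ### Entropic mirror descent steps over a convex subset of the simplex -/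

section Mirror

variable {m : ℕ} {Λ : Set (Fin m → ℝ)} {G lam y μ : Fin m → ℝ} {η' : ℝ}

/-- First-order optimality along the segment from `y` to `μ`. The slope is taken at the displaced
point rather than at `y`, where it could be infinite: a coordinate of `y` may vanish while that of
`μ` does not. -/
theorem IsMirrorStep.variational (h : IsMirrorStep Λ G η' lam y) (hη : 0 < η')
    (hΛ : Λ ⊆ stdSimplex ℝ (Fin m)) (hconv : Convex ℝ Λ) (hlam : ∀ i, 0 ≤ lam i)
    (hμ : μ ∈ Λ) (hdom : DomBy μ lam) {ε : ℝ} (h0 : 0 < ε) (h1 : ε < 1) :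
    0 ≤ η' * (G ⬝ᵥ μ - G ⬝ᵥ y) +
      ∑ i, (μ i - y i) * Real.log ((y i + ε * (μ i - y i)) / lam i) := by
  set z : Fin m → ℝ := (1 - ε) • y + ε • μ with hz
  have hzΛ : z ∈ Λ := hconv h.mem hμ (by linarith) h0.le (by ring)
  have hzi : ∀ i, z i = y i + ε * (μ i - y i) := by intro i; simp [hz]; ring
  have hyS := hΛ h.mem
  have hμS := hΛ hμ
  have hzd : DomBy z lam := by
    intro i hi
    simp [hz, h.domBy i hi, hdom i hi]
  have hmin := h.le z hzΛ hzd
  have hkl : klVec z lam - klVec y lam ≤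
      ε * ∑ i, (μ i - y i) * Real.log ((y i + ε * (μ i - y i)) / lam i) := by
    have : klVec z lam - klVec y lam ≤ ∑ i, (z i - y i) * (Real.log (z i / lam i) + 1) := by
      rw [klVec, klVec, ← Finset.sum_sub_distrib]
      refine Finset.sum_le_sum fun i _ => ?_
      rcases (hlam i).eq_or_lt with hl | hl
      · simp [h.domBy i hl.symm, hzd i hl.symm]
      · rcases ((hΛ hzΛ).1 i).eq_or_lt with hzz | hzz
        · have hy0 : y i = 0 := by
            have := hyS.1 i
            have := hμS.1 i
            have : z i = (1 - ε) * y i + ε * μ i := by simp [hz]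
            nlinarith [mul_nonneg h0.le (hμS.1 i)]
          simp [← hzz, hy0]
        · exact mul_log_div_sub_le hl (hyS.1 i) hzz
    refine this.trans (le_of_eq ?_)
    have e : ∑ i, (z i - y i) = 0 := by
      rw [Finset.sum_sub_distrib, (hΛ hzΛ).2, hyS.2, sub_self]
    simp only [mul_add, mul_one, Finset.sum_add_distrib, e, add_zero, Finset.mul_sum]
    refine Finset.sum_congr rfl fun i _ => ?_
    rw [hzi, add_sub_cancel_left, mul_assoc]
  have hG : G ⬝ᵥ z = G ⬝ᵥ y + ε * (G ⬝ᵥ μ - G ⬝ᵥ y) := by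
    simp only [hz, dotProduct_add, dotProduct_smul, smul_eq_mul]; ring
  rw [hG] at hmin
  have h3 : 0 ≤ ε * (G ⬝ᵥ μ - G ⬝ᵥ y) + (klVec z lam - klVec y lam) / η' := by
    rw [sub_div]; linarith
  have h4 : 0 ≤ η' * (ε * (G ⬝ᵥ μ - G ⬝ᵥ y)) + (klVec z lam - klVec y lam) := by
    have := mul_nonneg hη.le h3
    rwa [mul_add, mul_div_cancel₀ _ hη.ne'] at this
  refine nonneg_of_mul_nonneg_right (a := ε) ?_ h0
  rw [mul_add]
  linarith

/-- Slopes of a convex function increase along a segment; the value at the midpoint is a bound that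
does not depend on `ε`. -/
theorem segment_log_mono {a b c ε : ℝ} (ha : 0 ≤ a) (hb : 0 ≤ b) (hc : 0 < c) (h0 : 0 < ε)
    (h1 : ε ≤ 1 / 2) :
    (b - a) * Real.log ((a + ε * (b - a)) / c) ≤
      (b - a) * Real.log ((a + 1 / 2 * (b - a)) / c) := by
  rcases lt_trichotomy a b with h | h | h
  · refine mul_le_mul_of_nonneg_left (Real.log_le_log ?_ ?_) (by linarith)
    · have : 0 < a + ε * (b - a) := by nlinarith [mul_pos h0 (sub_pos.2 h)]
      positivity
    · gcongr
  · simp [h]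
  · refine mul_le_mul_of_nonpos_left (Real.log_le_log ?_ ?_) (by linarith)
    · have : 0 < a + 1 / 2 * (b - a) := by linarith
      positivity
    · refine div_le_div_of_nonneg_right ?_ hc.le
      nlinarith

/-- The entropy acts as a barrier. If `y j = 0 < μ j`, the slope towards `μ` contains `μ j * log (ε
* μ j / lam j)`, which tends to `-∞` as `ε → 0` while the other terms stay bounded above,
contradicting optimality. -/
theorem IsMirrorStep.domBy_of_mem (h : IsMirrorStep Λ G η' lam y) (hη : 0 < η')
    (hΛ : Λ ⊆ stdSimplex ℝ (Fin m)) (hconv : Convex ℝ Λ) (hlam : ∀ i, 0 ≤ lam i)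
    (hμ : μ ∈ Λ) (hdom : DomBy μ lam) : DomBy μ y := by
  intro j hj
  by_contra hne
  have hμj : 0 < μ j := lt_of_le_of_ne ((hΛ hμ).1 j) (Ne.symm hne)
  have hlj : 0 < lam j := lt_of_le_of_ne (hlam j) fun e => hne (hdom j e.symm)
  set T : ℝ → Fin m → ℝ := fun ε i => (μ i - y i) * Real.log ((y i + ε * (μ i - y i)) / lam i)
  set C : ℝ := η' * (G ⬝ᵥ μ - G ⬝ᵥ y) + ∑ i ∈ Finset.univ.erase j, T (1 / 2) i
  have bound : ∀ ε : ℝ, 0 < ε → ε ≤ 1 / 2 → 0 ≤ C + μ j * Real.log (ε * (μ j / lam j)) := by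
    intro ε h0 h1
    have hv := h.variational hη hΛ hconv hlam hμ hdom h0 (by linarith)
    rw [← Finset.sum_erase_add _ _ (Finset.mem_univ j)] at hv
    have hle : ∑ i ∈ Finset.univ.erase j, T ε i ≤ ∑ i ∈ Finset.univ.erase j, T (1 / 2) i := by
      refine Finset.sum_le_sum fun i _ => ?_
      rcases (hlam i).eq_or_lt with hl | hl
      · simp [T, ← hl]
      · exact segment_log_mono ((hΛ h.mem).1 i) ((hΛ hμ).1 i) hl h0 h1
    have e : T ε j = μ j * Real.log (ε * (μ j / lam j)) := by
      simp [T, hj, mul_div_assoc]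
    have : T ε j = (μ j - y j) * Real.log ((y j + ε * (μ j - y j)) / lam j) := rfl
    rw [← this, e] at hv
    simp only [C]
    have hv' : 0 ≤ η' * (G ⬝ᵥ μ - G ⬝ᵥ y) +
      (∑ i ∈ Finset.univ.erase j, T ε i + μ j * Real.log (ε * (μ j / lam j))) := hv
    linarith
  set q := μ j / lam j
  have hq : 0 < q := div_pos hμj hlj
  have hlim : Filter.Tendsto (fun ε : ℝ => μ j * Real.log (ε * q))
      (nhdsWithin 0 (Set.Ioi 0)) Filter.atBot := by
    refine Filter.Tendsto.const_mul_atBot hμj ?_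
    refine Real.tendsto_log_nhdsGT_zero.comp ?_
    refine tendsto_nhdsWithin_iff.2 ⟨?_, ?_⟩
    · have : Filter.Tendsto (fun ε : ℝ => ε * q) (nhds 0) (nhds (0 * q)) :=
        (continuous_id.mul continuous_const).tendsto 0
      rw [zero_mul] at this
      exact this.mono_left nhdsWithin_le_nhds
    · filter_upwards [self_mem_nhdsWithin] with ε hε using mul_pos hε hq
  have h1 := hlim.eventually (Filter.eventually_lt_atBot (-C))
  have h2 : ∀ᶠ ε : ℝ in nhdsWithin 0 (Set.Ioi 0), ε ≤ 1 / 2 :=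
    (eventually_le_nhds (by norm_num)).filter_mono nhdsWithin_le_nhds
  obtain ⟨ε, ⟨ha, hb⟩, hc⟩ := ((h1.and h2).and self_mem_nhdsWithin).exists
  have := bound ε hc hb
  linarith

/-- The three-point inequality for a mirror descent step. -/
theorem IsMirrorStep.three_point (h : IsMirrorStep Λ G η' lam y) (hη : 0 < η')
    (hΛ : Λ ⊆ stdSimplex ℝ (Fin m)) (hconv : Convex ℝ Λ) (hlam : ∀ i, 0 ≤ lam i)
    (hμ : μ ∈ Λ) (hdom : DomBy μ lam) :
    G ⬝ᵥ y + klVec y lam / η' + klVec μ y / η' ≤ G ⬝ᵥ μ + klVec μ lam / η' := by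
  have hd := h.domBy_of_mem hη hΛ hconv hlam hμ hdom
  -- Let `ε → 0` in `variational`. Where `y` vanishes so does `μ`, by the barrier property, so no
  -- logarithm blows up.
  have hlim : Filter.Tendsto (fun ε : ℝ => η' * (G ⬝ᵥ μ - G ⬝ᵥ y) +
      ∑ i, (μ i - y i) * Real.log ((y i + ε * (μ i - y i)) / lam i))
      (nhdsWithin 0 (Set.Ioi 0)) (nhds (η' * (G ⬝ᵥ μ - G ⬝ᵥ y) +
        ∑ i, (μ i - y i) * Real.log (y i / lam i))) := by
    refine Filter.Tendsto.mono_left ?_ nhdsWithin_le_nhds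
    refine tendsto_const_nhds.add (tendsto_finsetSum _ fun i _ => ?_)
    rcases ((hΛ h.mem).1 i).eq_or_lt with h0 | h0
    · simp [← h0, hd i h0.symm]
    · have hl : lam i ≠ 0 := fun e => h0.ne' (h.domBy i e)
      refine tendsto_const_nhds.mul ?_
      have hc : ContinuousAt (fun ε : ℝ => (y i + ε * (μ i - y i)) / lam i) 0 := by fun_prop
      have := (hc.log (by simp [h0.ne', hl])).tendsto
      simpa using this
  have hge : 0 ≤ η' * (G ⬝ᵥ μ - G ⬝ᵥ y) + ∑ i, (μ i - y i) * Real.log (y i / lam i) := by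
    refine ge_of_tendsto hlim ?_
    have h2 : ∀ᶠ ε : ℝ in nhdsWithin 0 (Set.Ioi 0), ε < 1 :=
      (eventually_lt_nhds one_pos).filter_mono nhdsWithin_le_nhds
    filter_upwards [h2, self_mem_nhdsWithin] with ε h1 h0
    exact h.variational hη hΛ hconv hlam hμ hdom h0 h1
  have e : ∑ i, (μ i - y i) * Real.log (y i / lam i) =
      klVec μ lam - klVec μ y - klVec y lam := by
    rw [klVec, klVec, klVec, ← Finset.sum_sub_distrib, ← Finset.sum_sub_distrib]
    refine Finset.sum_congr rfl fun i _ => ?_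
    rcases ((hΛ hμ).1 i).eq_or_lt with h0 | h0
    · simp [← h0]
    · have hy : y i ≠ 0 := fun e => h0.ne' (hd i e)
      have hl : lam i ≠ 0 := fun e => h0.ne' (hdom i e)
      rw [Real.log_div hy hl, Real.log_div h0.ne' hl, Real.log_div h0.ne' hy]
      ring
  rw [e] at hge
  have h5 : 0 ≤ (G ⬝ᵥ μ - G ⬝ᵥ y) + (klVec μ lam - klVec μ y - klVec y lam) / η' := by
    have := div_nonneg hge hη.le
    rwa [add_div, mul_div_cancel_left₀ _ hη.ne'] at this
  rw [sub_div, sub_div] at h5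
  linarith

end Mirror

noncomputable section

/-! ### Occupancy measures, Bellman equations -/

namespace MOMDP

variable {S A : Type*} [Fintype S] [Fintype A] [DecidableEq S] {m : ℕ}
  {M : MOMDP S A m} {π π' : S → A → ℝ}

/-- The expected value of `f` at the next state. -/
def next (M : MOMDP S A m) (f : S → ℝ) (s : S) (a : A) : ℝ := ∑ s', M.P s a s' * f s'

/-- The expected discounted number of visits to `s` from `s₀`. -/
def occ (M : MOMDP S A m) (π : S → A → ℝ) (s₀ s : S) : ℝ :=
  ∑' t : ℕ, M.γ ^ t * M.stateProb π s₀ t s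

theorem one_sub_γ_pos (M : MOMDP S A m) : 0 < 1 - M.γ := sub_pos.2 M.γ_lt_one

theorem stateProb_nonneg (hπ : IsPolicy π) (s₀ : S) (t : ℕ) (s : S) :
    0 ≤ M.stateProb π s₀ t s := by
  induction t generalizing s with
  | zero =>
    by_cases h : s = s₀
    · subst h; simp [stateProb]
    · simp [stateProb, h]
  | succ t ih =>
    exact Finset.sum_nonneg fun x _ => Finset.sum_nonneg fun a _ =>
      mul_nonneg (mul_nonneg (ih x) ((hπ x).1 a)) ((M.P_mem x a).1 s)

theorem stateProb_sum (hπ : IsPolicy π) (s₀ : S) (t : ℕ) : ∑ s, M.stateProb π s₀ t s = 1 := by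
  induction t with
  | zero => simp [stateProb]
  | succ t ih =>
    simp only [stateProb]
    rw [Finset.sum_comm]
    rw [← ih]
    refine Finset.sum_congr rfl fun s _ => ?_
    rw [Finset.sum_comm]
    simp only [← Finset.mul_sum, (M.P_mem s _).2, mul_one, (hπ s).2]

theorem stateProb_le_one (hπ : IsPolicy π) (s₀ : S) (t : ℕ) (s : S) :
    M.stateProb π s₀ t s ≤ 1 := by
  rw [← M.stateProb_sum hπ s₀ t]
  exact Finset.single_le_sum (fun x _ => M.stateProb_nonneg hπ s₀ t x) (Finset.mem_univ s)

theorem norm_discounted_le (hπ : IsPolicy π) (s₀ : S) (t : ℕ) (s : S) :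
    ‖M.γ ^ t * M.stateProb π s₀ t s‖ ≤ M.γ ^ t := by
  have h := pow_nonneg M.γ_pos.le t
  rw [Real.norm_of_nonneg (mul_nonneg h (M.stateProb_nonneg hπ s₀ t s))]
  exact mul_le_of_le_one_right h (M.stateProb_le_one hπ s₀ t s)

theorem summable_γ (M : MOMDP S A m) : Summable fun t : ℕ => M.γ ^ t :=
  summable_geometric_of_lt_one M.γ_pos.le M.γ_lt_one

theorem summable_discounted (hπ : IsPolicy π) (s₀ s : S) :
    Summable fun t : ℕ => M.γ ^ t * M.stateProb π s₀ t s :=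
  Summable.of_norm_bounded M.summable_γ fun t => M.norm_discounted_le hπ s₀ t s

theorem occ_nonneg (hπ : IsPolicy π) (s₀ s : S) : 0 ≤ M.occ π s₀ s :=
  tsum_nonneg fun t => mul_nonneg (pow_nonneg M.γ_pos.le t) (M.stateProb_nonneg hπ s₀ t s)

theorem occ_flow (hπ : IsPolicy π) (s₀ s' : S) :
    M.occ π s₀ s' = (Pi.single s₀ 1 : S → ℝ) s' +
      M.γ * ∑ s, M.occ π s₀ s * ∑ a, π s a * M.P s a s' := by
  rw [occ, (M.summable_discounted hπ s₀ s').tsum_eq_zero_add]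
  congr 1
  · simp [stateProb]
  · have e : ∀ t, M.γ ^ (t + 1) * M.stateProb π s₀ (t + 1) s' =
        M.γ * ∑ s, (M.γ ^ t * M.stateProb π s₀ t s) * ∑ a, π s a * M.P s a s' := by
      intro t
      simp only [stateProb, Finset.mul_sum]
      refine Finset.sum_congr rfl fun s _ => Finset.sum_congr rfl fun a _ => ?_
      ring
    simp only [e]
    rw [tsum_mul_left, Summable.tsum_finsetSum]
    · simp only [tsum_mul_right, occ]
    · exact fun s _ => (M.summable_discounted hπ s₀ s).mul_right _

theorem tsum_visit (s₀ s : S) (a : A) :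
    ∑' t : ℕ, M.γ ^ t * (M.stateProb π s₀ t s * π s a) = M.occ π s₀ s * π s a := by
  rw [occ, ← tsum_mul_right]
  simp only [mul_assoc]

theorem stateVisit_eq (hπ : IsPolicy π) (s : S) :
    M.stateVisit π s = (1 - M.γ) * ∑ s₀, M.ρ s₀ * M.occ π s₀ s := by
  simp only [stateVisit, visit, tsum_visit]
  rw [← Finset.mul_sum, Finset.sum_comm]
  simp only [← Finset.mul_sum, (hπ s).2, mul_one]

theorem visit_eq (hπ : IsPolicy π) (s : S) (a : A) :
    M.visit π s a = M.stateVisit π s * π s a := by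
  rw [stateVisit_eq hπ]
  simp only [visit, tsum_visit]
  rw [mul_assoc, Finset.sum_mul]
  simp only [mul_assoc]

theorem stateVisit_nonneg (hπ : IsPolicy π) (s : S) : 0 ≤ M.stateVisit π s := by
  rw [stateVisit_eq hπ]
  exact mul_nonneg M.one_sub_γ_pos.le (Finset.sum_nonneg fun s₀ _ =>
    mul_nonneg (M.ρ_mem.1 s₀) (M.occ_nonneg hπ s₀ s))

theorem stateVisit_flow (hπ : IsPolicy π) (s' : S) :
    M.stateVisit π s' = (1 - M.γ) * M.ρ s' +
      M.γ * ∑ s, M.stateVisit π s * ∑ a, π s a * M.P s a s' := by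
  simp only [stateVisit_eq hπ]
  conv_lhs => simp only [M.occ_flow hπ _ s']
  simp only [mul_add, Finset.sum_add_distrib]
  congr 1
  · simp [Pi.single_apply]
  · simp only [Finset.mul_sum, Finset.sum_mul]
    rw [Finset.sum_comm]
    refine Finset.sum_congr rfl fun s _ => ?_
    rw [Finset.sum_comm]
    refine Finset.sum_congr rfl fun a _ => Finset.sum_congr rfl fun x _ => ?_
    ring

/-- The flow equation tested against a function. Normalisation, the performance difference identity
and confinement to closed sets all come from a choice of `f`. -/
theorem sum_stateVisit_flow (hπ : IsPolicy π) (f : S → ℝ) :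
    ∑ s, M.stateVisit π s * (f s - M.γ * ∑ a, π s a * M.next f s a) =
      (1 - M.γ) * ∑ s, M.ρ s * f s := by
  have h : ∑ s', M.stateVisit π s' * f s' = (1 - M.γ) * ∑ s, M.ρ s * f s +
      ∑ s, M.stateVisit π s * (M.γ * ∑ a, π s a * M.next f s a) := by
    conv_lhs => enter [2, s']; rw [M.stateVisit_flow hπ s']
    simp only [add_mul, Finset.sum_add_distrib]
    congr 1
    · rw [Finset.mul_sum]
      exact Finset.sum_congr rfl fun s _ => by ring
    · simp only [next, Finset.mul_sum, Finset.sum_mul]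
      rw [Finset.sum_comm]
      refine Finset.sum_congr rfl fun s _ => ?_
      rw [Finset.sum_comm]
      refine Finset.sum_congr rfl fun a _ => Finset.sum_congr rfl fun x _ => ?_
      ring
  simp only [mul_sub, Finset.sum_sub_distrib]
  rw [h]; ring

theorem next_const (c : ℝ) (s : S) (a : A) : M.next (fun _ => c) s a = c := by
  rw [next, ← Finset.sum_mul, (M.P_mem s a).2, one_mul]

theorem stateVisit_mem (hπ : IsPolicy π) : M.stateVisit π ∈ stdSimplex ℝ S := by
  refine ⟨M.stateVisit_nonneg hπ, ?_⟩
  have h := M.sum_stateVisit_flow hπ fun _ => 1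
  simp only [next_const, mul_one, (hπ _).2, ← Finset.sum_mul, M.ρ_mem.2] at h
  have := M.one_sub_γ_pos
  exact mul_right_cancel₀ this.ne' (by rw [h, one_mul])

theorem stateValue_eq (hπ : IsPolicy π) (r : S → A → ℝ) (s₀ : S) :
    M.stateValue r π s₀ = ∑ s, M.occ π s₀ s * ∑ a, π s a * r s a := by
  have e : ∀ t, M.γ ^ t * ∑ s, ∑ a, M.stateProb π s₀ t s * π s a * r s a =
      ∑ s, (M.γ ^ t * M.stateProb π s₀ t s) * ∑ a, π s a * r s a := by
    intro t
    simp only [Finset.mul_sum]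
    exact Finset.sum_congr rfl fun s _ => Finset.sum_congr rfl fun a _ => by ring
  simp only [stateValue, e]
  rw [Summable.tsum_finsetSum]
  · simp only [tsum_mul_right, occ]
  · exact fun s _ => (M.summable_discounted hπ s₀ s).mul_right _

theorem value_eq (hπ : IsPolicy π) (r : S → A → ℝ) :
    M.value r π = (∑ s, M.stateVisit π s * ∑ a, π s a * r s a) / (1 - M.γ) := by
  rw [eq_div_iff M.one_sub_γ_pos.ne']
  simp only [value, stateValue_eq hπ, stateVisit_eq hπ]
  simp only [Finset.mul_sum, Finset.sum_mul]
  rw [Finset.sum_comm]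
  refine Finset.sum_congr rfl fun s _ => ?_
  rw [Finset.sum_comm]
  refine Finset.sum_congr rfl fun a _ => Finset.sum_congr rfl fun x _ => ?_
  ring

/-- `f` solves the Bellman equation of the policy `π` with reward `r`. -/
def IsValueFun (M : MOMDP S A m) (r : S → A → ℝ) (π : S → A → ℝ) (f : S → ℝ) : Prop :=
  ∀ s, f s = ∑ a, π s a * (r s a + M.γ * M.next f s a)

/-- The flow equation says that the occupancy matrix is a left inverse of `1 - γ Q`. For square
matrices it is then also a right inverse, so applying it to the expected rewards solves the Bellman
equation. -/
theorem exists_isValueFun (M : MOMDP S A m) (r : S → A → ℝ) (hπ : IsPolicy π) :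
    ∃ f, M.IsValueFun r π f := by
  set N : Matrix S S ℝ := M.occ π
  set Q : Matrix S S ℝ := fun s s' => ∑ a, π s a * M.P s a s'
  have h1 : N * (1 - M.γ • Q) = 1 := by
    ext s₀ s'
    have := M.occ_flow hπ s₀ s'
    rw [Matrix.mul_sub, Matrix.mul_one, Matrix.sub_apply, Matrix.mul_smul, Matrix.smul_apply,
      Matrix.mul_apply, smul_eq_mul]
    simp only [N, Q]
    rw [Matrix.one_apply, this, Pi.single_apply]
    simp only [eq_comm]
    ring
  have h2 := mul_eq_one_comm.1 h1
  set c : S → ℝ := fun s => ∑ a, π s a * r s a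
  refine ⟨N.mulVec c, fun s => ?_⟩
  have h3 : (1 - M.γ • Q).mulVec (N.mulVec c) = c := by
    rw [Matrix.mulVec_mulVec, h2, Matrix.one_mulVec]
  have h4 := congrFun h3 s
  rw [Matrix.sub_mulVec, Matrix.one_mulVec, Matrix.smul_mulVec, Pi.sub_apply, Pi.smul_apply,
    smul_eq_mul] at h4
  have h5 : ∑ a, π s a * (r s a + M.γ * M.next (N.mulVec c) s a) =
      c s + M.γ * Q.mulVec (N.mulVec c) s := by
    simp only [mul_add, Finset.sum_add_distrib, c]
    congr 1
    generalize N.mulVec c = w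
    simp only [Matrix.mulVec, dotProduct, Q, next, Finset.sum_mul, Finset.mul_sum]
    rw [Finset.sum_comm]
    refine Finset.sum_congr rfl fun a _ => Finset.sum_congr rfl fun x _ => ?_
    ring
  rw [h5]; linarith

/-- The performance difference identity, for an arbitrary baseline `f`. -/
theorem value_sub_baseline (hπ : IsPolicy π) (r : S → A → ℝ) (f : S → ℝ) :
    M.value r π - ∑ s, M.ρ s * f s =
      (∑ s, M.stateVisit π s * (∑ a, π s a * (r s a + M.γ * M.next f s a) - f s)) /
        (1 - M.γ) := by
  have h := M.sum_stateVisit_flow hπ f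
  have hγ := M.one_sub_γ_pos.ne'
  rw [value_eq hπ, eq_div_iff hγ, sub_mul, div_mul_cancel₀ _ hγ, mul_comm _ (1 - M.γ), ← h,
    ← Finset.sum_sub_distrib]
  refine Finset.sum_congr rfl fun s _ => ?_
  simp only [mul_add, Finset.sum_add_distrib]
  have : ∑ a, π s a * (M.γ * M.next f s a) = M.γ * ∑ a, π s a * M.next f s a := by
    rw [Finset.mul_sum]
    exact Finset.sum_congr rfl fun a _ => by ring
  rw [this]; ring

theorem IsValueFun.sum_eq {r : S → A → ℝ} {f : S → ℝ} (hf : M.IsValueFun r π f)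
    (hπ : IsPolicy π) : ∑ s, M.ρ s * f s = M.value r π := by
  have h := M.value_sub_baseline hπ r f
  simp only [← hf _, sub_self, mul_zero, Finset.sum_const_zero, zero_div] at h
  linarith

/-- `R` cannot be left. -/
def IsClosedSet (M : MOMDP S A m) (R : Set S) : Prop :=
  ∀ s ∈ R, ∀ a s', M.P s a s' ≠ 0 → s' ∈ R

theorem IsClosedSet.next_le {R : Set S} (hR : M.IsClosedSet R) {f g : S → ℝ} {c : ℝ}
    (h : ∀ s ∈ R, f s ≤ g s + c) {s : S} (hs : s ∈ R) (a : A) :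
    M.next f s a ≤ M.next g s a + c := by
  calc M.next f s a ≤ ∑ s', (M.P s a s' * g s' + M.P s a s' * c) := by
        refine Finset.sum_le_sum fun s' _ => ?_
        by_cases h0 : M.P s a s' = 0
        · simp [h0]
        · rw [← mul_add]
          exact mul_le_mul_of_nonneg_left (h s' (hR s hs a s' h0)) ((M.P_mem s a).1 s')
    _ = _ := by rw [Finset.sum_add_distrib, ← Finset.sum_mul, (M.P_mem s a).2, one_mul, next]

/-- The comparison principle for policy evaluation. -/
theorem IsClosedSet.le_of_sub_le {R : Set S} (hR : M.IsClosedSet R) (hπ : IsPolicy π)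
    {f g : S → ℝ} {c : ℝ}
    (h : ∀ s ∈ R, f s - g s ≤ c + M.γ * ∑ a, π s a * (M.next f s a - M.next g s a)) :
    ∀ s ∈ R, f s ≤ g s + c / (1 - M.γ) := by
  classical
  -- At a state of `R` maximising `f - g`, the averaged next-state difference is at most the maximum
  -- itself, because `R` cannot be left. Hence `(1 - γ)` times the maximum is at most `c`.
  intro s hs
  obtain ⟨x, hx, hmax⟩ := Finset.exists_max_image (Finset.univ.filter (· ∈ R))
    (fun s => f s - g s) ⟨s, by simpa using hs⟩
  replace hx : x ∈ R := by simpa using hx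
  have hle : ∀ y ∈ R, f y ≤ g y + (f x - g x) := fun y hy => by
    have := hmax y (by simpa using hy)
    linarith
  have h1 : ∑ a, π x a * (M.next f x a - M.next g x a) ≤ f x - g x := by
    calc _ ≤ ∑ a, π x a * (f x - g x) := by
          refine Finset.sum_le_sum fun a _ => mul_le_mul_of_nonneg_left ?_ ((hπ x).1 a)
          linarith [hR.next_le hle hx a]
      _ = _ := by rw [← Finset.sum_mul, (hπ x).2, one_mul]
  have h2 := h x hx
  have h3 : f x - g x ≤ c / (1 - M.γ) := by
    rw [le_div_iff₀ M.one_sub_γ_pos]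
    nlinarith [mul_le_mul_of_nonneg_left h1 M.γ_pos.le]
  linarith [hle s hs]

theorem isClosedSet_univ : M.IsClosedSet Set.univ := fun _ _ _ _ _ => trivial

theorem IsValueFun.le_of_le {R : Set S} (hR : M.IsClosedSet R) (hπ : IsPolicy π)
    {r : S → A → ℝ} {f : S → ℝ} (hf : M.IsValueFun r π f) {c : ℝ}
    (h : ∀ s ∈ R, ∑ a, π s a * r s a ≤ c) : ∀ s ∈ R, f s ≤ c / (1 - M.γ) := by
  have := hR.le_of_sub_le hπ (f := f) (g := fun _ => 0) (c := c) fun s hs => by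
    rw [hf s]
    simp only [next_const, sub_zero, mul_add, Finset.sum_add_distrib]
    refine add_le_add (h s hs) (le_of_eq ?_)
    rw [Finset.mul_sum]
    exact Finset.sum_congr rfl fun a _ => by ring
  simpa using this

theorem IsValueFun.ge_of_ge {R : Set S} (hR : M.IsClosedSet R) (hπ : IsPolicy π)
    {r : S → A → ℝ} {f : S → ℝ} (hf : M.IsValueFun r π f) {c : ℝ}
    (h : ∀ s ∈ R, c ≤ ∑ a, π s a * r s a) : ∀ s ∈ R, c / (1 - M.γ) ≤ f s := by
  have := hR.le_of_sub_le hπ (f := fun _ => 0) (g := f) (c := -c) fun s hs => by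
    rw [hf s]
    simp only [next_const, zero_sub, mul_add, Finset.sum_add_distrib]
    have e : M.γ * ∑ a, π s a * -M.next f s a = - ∑ a, π s a * (M.γ * M.next f s a) := by
      rw [Finset.mul_sum, ← Finset.sum_neg_distrib]
      exact Finset.sum_congr rfl fun a _ => by ring
    rw [e]
    linarith [h s hs]
  intro s hs
  have := this s hs
  rw [neg_div] at this
  linarith

/-- Values with rewards in `[0, 1]` are Lipschitz in the policy. -/
theorem abs_value_sub_le (hπ : IsPolicy π) (hπ' : IsPolicy π') {r : S → A → ℝ}
    (hr : ∀ s a, r s a ∈ Set.Icc (0 : ℝ) 1) :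
    |M.value r π - M.value r π'| ≤
      (∑ s, M.stateVisit π s * l1norm (π s - π' s)) / (1 - M.γ) ^ 2 := by
  obtain ⟨f, hf⟩ := M.exists_isValueFun r hπ'
  have hγ := M.one_sub_γ_pos
  have hsum1 : ∀ s, ∑ a, π' s a * r s a ≤ 1 := fun s => by
    rw [← (hπ' s).2]
    exact Finset.sum_le_sum fun a _ => mul_le_of_le_one_right ((hπ' s).1 a) (hr s a).2
  have hf1 := hf.le_of_le M.isClosedSet_univ hπ' fun s _ => hsum1 s
  have hf0 := hf.ge_of_ge M.isClosedSet_univ hπ' (c := 0) fun s _ =>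
    Finset.sum_nonneg fun a _ => mul_nonneg ((hπ' s).1 a) (hr s a).1
  -- One factor `1 / (1 - γ)` comes from this bound on the action values, the other from the
  -- performance difference identity with the value function of `π'` as baseline.
  have hq : ∀ s a, |r s a + M.γ * M.next f s a| ≤ 1 / (1 - M.γ) := by
    intro s a
    have hn0 : 0 ≤ M.next f s a := Finset.sum_nonneg fun s' _ =>
      mul_nonneg ((M.P_mem s a).1 s') (by simpa using hf0 s' trivial)
    have hn1 : M.next f s a ≤ 1 / (1 - M.γ) := by
      have := M.isClosedSet_univ.next_le (f := f) (g := fun _ => 0) (c := 1 / (1 - M.γ))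
        (fun s hs => by simpa using hf1 s hs) (Set.mem_univ s) a
      simpa [next_const] using this
    rw [abs_of_nonneg (add_nonneg (hr s a).1 (mul_nonneg M.γ_pos.le hn0))]
    have : 1 / (1 - M.γ) = 1 + M.γ * (1 / (1 - M.γ)) := by field_simp; ring
    rw [this]
    exact add_le_add (hr s a).2 (mul_le_mul_of_nonneg_left hn1 M.γ_pos.le)
  rw [← hf.sum_eq hπ', value_sub_baseline hπ, abs_div, abs_of_pos hγ, pow_two, ← div_div]
  refine div_le_div_of_nonneg_right ?_ hγ.le
  rw [le_div_iff₀ hγ, ← le_div_iff₀ hγ, Finset.sum_div]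
  refine (Finset.abs_sum_le_sum_abs _ _).trans (Finset.sum_le_sum fun s _ => ?_)
  rw [abs_mul, abs_of_nonneg (M.stateVisit_nonneg hπ s), mul_div_assoc]
  refine mul_le_mul_of_nonneg_left ?_ (M.stateVisit_nonneg hπ s)
  have e : ∑ a, π s a * (r s a + M.γ * M.next f s a) - f s = ∑ a, π s a * (r s a + M.γ * M.next f s a) -
      ∑ a, π' s a * (r s a + M.γ * M.next f s a) := by rw [← hf s]
  rw [e, ← Finset.sum_sub_distrib, l1norm, Finset.sum_div]
  refine (Finset.abs_sum_le_sum_abs _ _).trans (Finset.sum_le_sum fun a _ => ?_)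
  rw [← sub_mul, abs_mul, div_eq_mul_one_div]
  exact mul_le_mul_of_nonneg_left (hq s a) (abs_nonneg _)

/-- Lipschitz dependence on the policy, then Cauchy-Schwarz over the visitation distribution and
Pinsker's inequality at each state. -/
theorem norm_valueVec_sub_sq_le (hπ : IsPolicy π) (hπ' : IsPolicy π')
    (hdom : ∀ s, DomBy (π s) (π' s)) :
    ‖M.valueVec π - M.valueVec π'‖ ^ 2 ≤
      2 * (∑ s, M.stateVisit π s * klVec (π s) (π' s)) / (1 - M.γ) ^ 4 := by
  have hγ := M.one_sub_γ_pos
  set X := ∑ s, M.stateVisit π s * l1norm (π s - π' s)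
  have hX0 : 0 ≤ X := Finset.sum_nonneg fun s _ =>
    mul_nonneg (M.stateVisit_nonneg hπ s) (Finset.sum_nonneg fun _ _ => abs_nonneg _)
  have h1 : ‖M.valueVec π - M.valueVec π'‖ ≤ X / (1 - M.γ) ^ 2 := by
    rw [pi_norm_le_iff_of_nonneg (by positivity)]
    intro i
    exact M.abs_value_sub_le hπ hπ' (M.r_mem i)
  have h2 : X ^ 2 ≤ (∑ s, M.stateVisit π s) * ∑ s, M.stateVisit π s * (2 * klVec (π s) (π' s)) := by
    refine Finset.sum_sq_le_sum_mul_sum_of_sq_le_mul _ (fun s _ => M.stateVisit_nonneg hπ s)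
      (fun s _ => mul_nonneg (M.stateVisit_nonneg hπ s)
        (mul_nonneg two_pos.le (klVec_nonneg (hπ s) (hπ' s) (hdom s)))) fun s _ => ?_
    rw [mul_pow, ← mul_assoc, pow_two (M.stateVisit π s)]
    exact mul_le_mul_of_nonneg_left (sq_l1norm_sub_le (hπ s) (hπ' s) (hdom s))
      (mul_self_nonneg _)
  rw [(M.stateVisit_mem hπ).2, one_mul] at h2
  have h3 := pow_le_pow_left₀ (norm_nonneg _) h1 2
  refine h3.trans ?_
  rw [div_pow, ← pow_mul]
  refine div_le_div_of_nonneg_right (h2.trans (le_of_eq ?_)) (by positivity)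
  rw [Finset.mul_sum]
  exact Finset.sum_congr rfl fun s _ => by ring

end MOMDP

end

noncomputable section

/-! ### Softmax policies and the natural policy gradient step -/

section Softmax

variable {S A : Type*} [Fintype S] [Fintype A]

theorem softmax_pos (θ : S × A → ℝ) (s : S) (a : A) : 0 < softmax θ s a :=
  div_pos (Real.exp_pos _) (Finset.sum_pos (fun _ _ => Real.exp_pos _) ⟨a, Finset.mem_univ a⟩)

theorem isPolicy_softmax [Nonempty A] (θ : S × A → ℝ) : IsPolicy (softmax θ) := by
  intro s
  refine ⟨fun a => (softmax_pos θ s a).le, ?_⟩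
  have : ∑ a, Real.exp (θ (s, a)) ≠ 0 :=
    (Finset.sum_pos (fun _ _ => Real.exp_pos _) Finset.univ_nonempty).ne'
  simp only [softmax]
  rw [← Finset.sum_div, div_self this]

theorem log_softmax (θ : S × A → ℝ) (s : S) (a : A) :
    Real.log (softmax θ s a) = θ (s, a) - Real.log (∑ a', Real.exp (θ (s, a'))) := by
  have : ∑ a, Real.exp (θ (s, a)) ≠ 0 :=
    (Finset.sum_pos (fun _ _ => Real.exp_pos _) ⟨a, Finset.mem_univ a⟩).ne'
  rw [softmax, Real.log_div (Real.exp_pos _).ne' this, Real.log_exp]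

theorem domBy_softmax (x : A → ℝ) (θ : S × A → ℝ) (s : S) : DomBy x (softmax θ s) :=
  fun a h => absurd h (softmax_pos θ s a).ne'

/-- The derivative of `log π_θ(a|s)`. -/
def score (θ : S × A → ℝ) (s : S) (a : A) : (S × A → ℝ) →L[ℝ] ℝ :=
  ContinuousLinearMap.proj (s, a) - ∑ a', softmax θ s a' • ContinuousLinearMap.proj (s, a')

theorem score_apply (θ : S × A → ℝ) (s : S) (a : A) (v : S × A → ℝ) :
    score θ s a v = v (s, a) - ∑ a', softmax θ s a' * v (s, a') := by
  simp [score]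

theorem hasFDerivAt_log_softmax (θ : S × A → ℝ) (s : S) (a : A) :
    HasFDerivAt (fun θ' : S × A → ℝ => Real.log (softmax θ' s a)) (score θ s a) θ := by
  simp only [log_softmax]
  have hne : ∑ a, Real.exp (θ (s, a)) ≠ 0 :=
    (Finset.sum_pos (fun _ _ => Real.exp_pos _) ⟨a, Finset.mem_univ a⟩).ne'
  have hp : ∀ a' : A, HasFDerivAt (fun θ' : S × A → ℝ => θ' (s, a'))
      (ContinuousLinearMap.proj (R := ℝ) (φ := fun _ : S × A => ℝ) (s, a')) θ := fun a' =>
    (ContinuousLinearMap.proj (R := ℝ) (φ := fun _ : S × A => ℝ) (s, a')).hasFDerivAt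
  have hs := (HasFDerivAt.fun_sum (u := Finset.univ) fun a' _ => (hp a').exp).log hne
  refine ((hp a).sub hs).congr_fderiv ?_
  rw [score, Finset.smul_sum]
  congr 1
  refine Finset.sum_congr rfl fun a' _ => ?_
  rw [smul_smul, softmax, div_eq_inv_mul]

theorem hasFDerivAt_softmax (θ : S × A → ℝ) (s : S) (a : A) :
    HasFDerivAt (fun θ' : S × A → ℝ => softmax θ' s a) (softmax θ s a • score θ s a) θ := by
  have h := (hasFDerivAt_log_softmax θ s a).exp
  rw [Real.exp_log (softmax_pos θ s a)] at h
  refine h.congr_of_eventuallyEq (Filter.Eventually.of_forall fun θ' => ?_)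
  exact (Real.exp_log (softmax_pos θ' s a)).symm

theorem continuous_softmax (s : S) (a : A) : Continuous fun θ : S × A → ℝ => softmax θ s a :=
  continuous_iff_continuousAt.2 fun θ => (hasFDerivAt_softmax θ s a).continuousAt

theorem sum_softmax_mul_score [Nonempty A] (θ : S × A → ℝ) (s : S) (v : S × A → ℝ) :
    ∑ a, softmax θ s a * score θ s a v = 0 := by
  simp only [score_apply, mul_sub, Finset.sum_sub_distrib, ← Finset.sum_mul,
    (isPolicy_softmax θ s).2, one_mul, sub_self]

end Softmax

theorem grad_dotProduct {ι : Type*} [Fintype ι] [DecidableEq ι] (f : (ι → ℝ) → ℝ) (x v : ι → ℝ) :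
    grad f x ⬝ᵥ v = fderiv ℝ f x v := by
  conv_rhs => rw [pi_eq_sum_univ' v, map_sum]
  refine Finset.sum_congr rfl fun i _ => ?_
  rw [map_smul, smul_eq_mul, mul_comm, grad]

/-- The product rule where one factor vanishes and the other one is merely continuous. -/
theorem HasFDerivAt.continuousAt_mul_of_eq_zero {E : Type*} [NormedAddCommGroup E]
    [NormedSpace ℝ E] {g h : E → ℝ} {h' : E →L[ℝ] ℝ} {x : E} (hh : HasFDerivAt h h' x)
    (hg : ContinuousAt g x) (h0 : h x = 0) :
    HasFDerivAt (fun y => g y * h y) (g x • h') x := by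
  rw [hasFDerivAt_iff_isLittleO] at hh ⊢
  have h1 : (fun y => g y * (h y - h x - h' (y - x))) =o[nhds x] fun y => y - x := by
    simpa using (hg.isBigO_one ℝ).mul_isLittleO hh.norm_right |>.congr_right fun y => one_mul _
  have h2 : (fun y => (g y - g x) * h' (y - x)) =o[nhds x] fun y => y - x := by
    have hz : (fun y => g y - g x) =o[nhds x] fun _ => (1 : ℝ) := by
      rw [Asymptotics.isLittleO_one_iff]
      simpa using hg.sub_const (g x)
    have := hz.mul_isBigO (h'.isBigO_sub (nhds x) x).norm_right
    simpa using this
  refine (h1.add h2).congr_left fun y => ?_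
  simp [h0]; ring

/-! ### Policy gradient of the regularized value and its Fisher preimage -/

namespace MOMDP

variable {S A : Type*} [Fintype S] [Fintype A] [DecidableEq S] [DecidableEq A] {m : ℕ}
  {M : MOMDP S A m} {π π' : S → A → ℝ}

theorem continuous_stateProb_softmax (s₀ : S) (t : ℕ) (s : S) :
    Continuous fun θ : S × A → ℝ => M.stateProb (softmax θ) s₀ t s := by
  induction t generalizing s with
  | zero => simp only [stateProb]; exact continuous_const
  | succ t ih =>
    simp only [stateProb]
    refine continuous_finsetSum _ fun x _ => continuous_finsetSum _ fun a _ => ?_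
    exact ((ih x).mul (continuous_softmax x a)).mul continuous_const

theorem continuous_stateVisit_softmax [Nonempty A] (s : S) :
    Continuous fun θ : S × A → ℝ => M.stateVisit (softmax θ) s := by
  simp only [stateVisit_eq (isPolicy_softmax _)]
  refine continuous_const.mul (continuous_finsetSum _ fun s₀ _ => continuous_const.mul ?_)
  exact continuous_tsum (fun t => continuous_const.mul (continuous_stateProb_softmax s₀ t s))
    M.summable_γ fun t θ => M.norm_discounted_le (isPolicy_softmax θ) s₀ t s

/-- The reward that includes the KL penalty towards the anchor. -/
def regReward (r : S → A → ℝ) (α : ℝ) (π₀ π : S → A → ℝ) (s : S) (a : A) : ℝ :=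
  r s a - α * Real.log (π s a / π₀ s a)

theorem sum_mul_regReward (r : S → A → ℝ) (α : ℝ) (π₀ π : S → A → ℝ) (s : S) :
    ∑ a, π s a * regReward r α π₀ π s a = ∑ a, π s a * r s a - α * klVec (π s) (π₀ s) := by
  simp only [regReward, mul_sub, Finset.sum_sub_distrib, klVec, Finset.mul_sum]
  congr 1
  exact Finset.sum_congr rfl fun a _ => by ring

theorem value_regReward (hπ : IsPolicy π) (r : S → A → ℝ) (α : ℝ) (π₀ : S → A → ℝ) :
    M.value (regReward r α π₀ π) π =
      M.value r π - α * (∑ s, M.stateVisit π s * klVec (π s) (π₀ s)) / (1 - M.γ) := by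
  simp only [value_eq hπ, sum_mul_regReward, mul_sub, Finset.sum_sub_distrib, sub_div,
    Finset.mul_sum]
  congr 2
  exact Finset.sum_congr rfl fun a _ => by ring

theorem regValue_eq [Nonempty A] (r : S → A → ℝ) (α : ℝ) (θ₀ θ : S × A → ℝ) :
    M.regValue r α θ₀ θ = M.value (regReward r α (softmax θ₀) (softmax θ)) (softmax θ) := by
  rw [value_regReward (isPolicy_softmax θ), regValue]

theorem fisher_mulVec [Nonempty A] (θ v : S × A → ℝ) (s : S) (a : A) :
    (M.fisher θ).mulVec v (s, a) = M.stateVisit (softmax θ) s * softmax θ s a * score θ s a v := by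
  have hg : ∀ x b, grad (fun θ' => Real.log (softmax θ' x b)) θ (s, a) =
      score θ x b (Pi.single (s, a) 1) := fun x b => by
    rw [grad, (hasFDerivAt_log_softmax θ x b).fderiv]
  have hd : ∀ x b, grad (fun θ' => Real.log (softmax θ' x b)) θ ⬝ᵥ v = score θ x b v :=
    fun x b => by rw [grad_dotProduct, (hasFDerivAt_log_softmax θ x b).fderiv]
  have h1 : (M.fisher θ).mulVec v (s, a) = ∑ x, ∑ b, M.visit (softmax θ) x b *
      (score θ x b (Pi.single (s, a) 1) * score θ x b v) := by
    rw [fisher, Matrix.sum_mulVec, Finset.sum_apply]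
    refine Finset.sum_congr rfl fun x _ => ?_
    rw [Matrix.sum_mulVec, Finset.sum_apply]
    refine Finset.sum_congr rfl fun b _ => ?_
    rw [Matrix.smul_mulVec, Matrix.vecMulVec_mulVec, hd, Pi.smul_apply, Pi.smul_apply, hg]
    simp
  rw [h1, Finset.sum_eq_single s]
  · simp only [visit_eq (isPolicy_softmax θ)]
    have e : ∀ b, score θ s b (Pi.single (s, a) 1) =
        (Pi.single a 1 : A → ℝ) b - softmax θ s a := by
      intro b
      simp [score_apply, Pi.single_apply]
    simp only [e, sub_mul, mul_sub, Finset.sum_sub_distrib]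
    have h2 : ∑ b, M.stateVisit (softmax θ) s * softmax θ s b *
        (softmax θ s a * score θ s b v) = 0 := by
      have := sum_softmax_mul_score θ s v
      calc _ = M.stateVisit (softmax θ) s * softmax θ s a *
          ∑ b, softmax θ s b * score θ s b v := by
            rw [Finset.mul_sum]
            exact Finset.sum_congr rfl fun b _ => by ring
        _ = 0 := by rw [this, mul_zero]
    rw [h2, sub_zero]
    simp [Pi.single_apply]
  · intro x _ hx
    refine Finset.sum_eq_zero fun b _ => ?_
    have : score θ x b (Pi.single (s, a) 1) = 0 := by
      simp [score_apply, hx]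
    rw [this, zero_mul, mul_zero]
  · simp

/-- The policy gradient theorem without differentiating the visitation distribution. With the value
function at `θ` frozen as baseline, the factor multiplying `stateVisit` in the performance
difference vanishes at `θ`, so continuity of `stateVisit` is enough. The derivative of the penalty
inside the reward drops out because the score has mean zero. -/
theorem hasFDerivAt_regValue [Nonempty A] {r : S → A → ℝ} {α : ℝ} {θ₀ θ : S × A → ℝ} {f : S → ℝ}
    (hf : M.IsValueFun (regReward r α (softmax θ₀) (softmax θ)) (softmax θ) f) :
    HasFDerivAt (M.regValue r α θ₀)
      ((1 - M.γ)⁻¹ • ∑ s, M.stateVisit (softmax θ) s • ∑ a,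
        (regReward r α (softmax θ₀) (softmax θ) s a + M.γ * M.next f s a) •
          softmax θ s a • score θ s a) θ := by
  have e : M.regValue r α θ₀ = fun θ' => (1 - M.γ)⁻¹ * (∑ s, M.stateVisit (softmax θ') s *
      (∑ a, softmax θ' s a * (regReward r α (softmax θ₀) (softmax θ') s a +
        M.γ * M.next f s a) - f s)) + ∑ s, M.ρ s * f s := by
    funext θ'
    rw [regValue_eq, inv_mul_eq_div, ← value_sub_baseline (isPolicy_softmax θ')]
    ring
  rw [e]
  refine HasFDerivAt.add_const _ (HasFDerivAt.const_mul ?_ _)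
  refine HasFDerivAt.fun_sum fun s _ => ?_
  refine HasFDerivAt.continuousAt_mul_of_eq_zero ?_ (continuous_stateVisit_softmax s).continuousAt
    (by rw [← hf s, sub_self])
  refine HasFDerivAt.sub_const _ ?_
  have hl : ∀ a, HasFDerivAt (fun θ' => regReward r α (softmax θ₀) (softmax θ') s a +
      M.γ * M.next f s a) (-(α • score θ s a)) θ := by
    intro a
    have h1 : (fun θ' => regReward r α (softmax θ₀) (softmax θ') s a + M.γ * M.next f s a) =
        fun θ' => r s a - α * (Real.log (softmax θ' s a) - Real.log (softmax θ₀ s a)) +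
          M.γ * M.next f s a := by
      funext θ'
      rw [regReward, Real.log_div (softmax_pos _ _ _).ne' (softmax_pos _ _ _).ne']
    rw [h1]
    exact ((((hasFDerivAt_log_softmax θ s a).sub_const _).const_mul α).const_sub _).add_const _
  refine (HasFDerivAt.fun_sum fun a _ => (hasFDerivAt_softmax θ s a).mul (hl a)).congr_fderiv ?_
  ext v
  simp only [sum_apply, add_apply,
    smul_apply, neg_apply, smul_eq_mul,
    Finset.sum_add_distrib]
  have : ∑ a, softmax θ s a * -(α * score θ s a v) = 0 := by
    rw [← mul_zero (-α), ← sum_softmax_mul_score θ s v, Finset.mul_sum]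
    exact Finset.sum_congr rfl fun a _ => by ring
  rw [this, zero_add]

/-- The gradient lies in the range of the Fisher matrix, with the scaled regularized advantage as a
preimage. The Moore-Penrose inverse therefore returns this preimage up to the kernel. -/
theorem grad_regValue [Nonempty A] {r : S → A → ℝ} {α : ℝ} {θ₀ θ : S × A → ℝ} {f : S → ℝ}
    (hf : M.IsValueFun (regReward r α (softmax θ₀) (softmax θ)) (softmax θ) f) :
    grad (M.regValue r α θ₀) θ = (M.fisher θ).mulVec fun x =>
      (regReward r α (softmax θ₀) (softmax θ) x.1 x.2 + M.γ * M.next f x.1 x.2 - f x.1) /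
        (1 - M.γ) := by
  funext ⟨s, a⟩
  rw [fisher_mulVec, grad, (hasFDerivAt_regValue hf).fderiv]
  have hm : ∑ b, softmax θ s b * ((regReward r α (softmax θ₀) (softmax θ) s b +
      M.γ * M.next f s b - f s) / (1 - M.γ)) = 0 := by
    have := hf s
    simp only [mul_div_assoc', ← Finset.sum_div, mul_sub, Finset.sum_sub_distrib,
      ← Finset.sum_mul, (isPolicy_softmax θ s).2, one_mul, ← this, sub_self, zero_div]
  rw [score_apply]
  simp only [hm, sub_zero]
  simp only [smul_apply, sum_apply, smul_eq_mul]
  rw [Finset.sum_eq_single s]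
  · have e : ∀ b, score θ s b (Pi.single (s, a) 1) =
        (Pi.single a 1 : A → ℝ) b - softmax θ s a := by
      intro b
      simp [score_apply, Pi.single_apply]
    have h2 : ∑ b, (regReward r α (softmax θ₀) (softmax θ) s b + M.γ * M.next f s b) *
        (softmax θ s b * score θ s b (Pi.single (s, a) 1)) =
        softmax θ s a * (regReward r α (softmax θ₀) (softmax θ) s a + M.γ * M.next f s a - f s) := by
      simp only [e, mul_sub, Finset.sum_sub_distrib]
      congr 1
      · simp [Pi.single_apply]; ring
      · rw [hf s, Finset.mul_sum]
        exact Finset.sum_congr rfl fun b _ => by ring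
    rw [h2]; ring
  · intro x _ hx
    refine mul_eq_zero_of_right _ (Finset.sum_eq_zero fun b _ => ?_)
    have : score θ x b (Pi.single (s, a) 1) = 0 := by
      simp [score_apply, hx]
    rw [this, mul_zero, mul_zero]
  · simp

theorem _root_.IsMoorePenrose.mulVec_mulVec {ι : Type*} [Fintype ι] {F B : Matrix ι ι ℝ}
    (h : IsMoorePenrose F B) (w : ι → ℝ) :
    F.mulVec (B.mulVec (F.mulVec w)) = F.mulVec w := by
  rw [Matrix.mulVec_mulVec, Matrix.mulVec_mulVec, h.mul_mul_left]

/-- With step size `(1 - γ) / α` a natural policy gradient step is a step of soft policy iteration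
at the states that are visited. -/
theorem npg_step_of_visited [Nonempty A] {r : S → A → ℝ} {α : ℝ} (hα : 0 < α)
    {θ₀ θ : S × A → ℝ} {f : S → ℝ}
    (hf : M.IsValueFun (regReward r α (softmax θ₀) (softmax θ)) (softmax θ) f) {s : S}
    (hs : M.stateVisit (softmax θ) s ≠ 0) :
    ∃ c, ∀ a, α * Real.log (softmax (θ + ((1 - M.γ) / α) •
      (pinv (M.fisher θ)).mulVec (grad (M.regValue r α θ₀) θ)) s a / softmax θ₀ s a) =
        r s a + M.γ * M.next f s a - c := by
  rw [grad_regValue hf]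
  set w : S × A → ℝ := fun x =>
      (regReward r α (softmax θ₀) (softmax θ) x.1 x.2 + M.γ * M.next f x.1 x.2 - f x.1) /
        (1 - M.γ)
  have h1 := (pinv_spec _ (M.fisher_transpose θ)).mulVec_mulVec w
  set u := (pinv (M.fisher θ)).mulVec ((M.fisher θ).mulVec w)
  -- At a visited state, agreement modulo the Fisher kernel means equal scores: `u` and `w` differ
  -- there by a constant independent of the action, which goes into `c`.
  have hsc : ∀ a, score θ s a u = score θ s a w := by
    intro a
    have := congrFun h1 (s, a)
    rw [fisher_mulVec, fisher_mulVec] at this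
    exact mul_left_cancel₀ (mul_ne_zero hs (softmax_pos θ s a).ne') this
  set ū := ∑ a', softmax θ s a' * u (s, a')
  set w' := ∑ a', softmax θ s a' * w (s, a')
  set θ₁ := θ + ((1 - M.γ) / α) • u
  refine ⟨f s - α * Real.log (∑ a', Real.exp (θ (s, a'))) +
    α * Real.log (∑ a', Real.exp (θ₁ (s, a'))) - (1 - M.γ) * (ū - w'), fun a => ?_⟩
  have h2 := hsc a
  rw [score_apply, score_apply] at h2
  have h3 : u (s, a) = w (s, a) + (ū - w') := by linarith
  have h4 : θ₁ (s, a) = θ (s, a) + (1 - M.γ) / α * u (s, a) := rfl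
  have h5 : (1 - M.γ) * w (s, a) =
      regReward r α (softmax θ₀) (softmax θ) s a + M.γ * M.next f s a - f s :=
    mul_div_cancel₀ _ M.one_sub_γ_pos.ne'
  rw [regReward, Real.log_div (softmax_pos _ _ _).ne' (softmax_pos _ _ _).ne',
    log_softmax θ] at h5
  -- With this step size the term `-α log π_θ` in the advantage cancels `α θ` up to the normaliser,
  -- so the new policy depends on the current one only through `f`.
  have h6 : α * θ₁ (s, a) = α * θ (s, a) + ((1 - M.γ) * w (s, a) + (1 - M.γ) * (ū - w')) := by
    rw [h4, h3]
    field_simp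
  rw [Real.log_div (softmax_pos _ _ _).ne' (softmax_pos _ _ _).ne', log_softmax θ₁, mul_sub,
    mul_sub, h6, h5]
  ring

end MOMDP

end

noncomputable section

/-! ### Convergence of the inner loop -/

namespace MOMDP

variable {S A : Type*} [Fintype S] [Fintype A] [DecidableEq S] [DecidableEq A] {m : ℕ}
  {M : MOMDP S A m} {π π' : S → A → ℝ}

/-- Test the flow equation with the indicator `g` of the complement of `R`. The expected next value
of `g` is at most `g`, and `g` has no initial mass, so its mass under the visitation distribution is
at most 0. -/
theorem IsClosedSet.mem_of_stateVisit_ne_zero {R : Set S} (hR : M.IsClosedSet R)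
    (hρ : ∀ s, M.ρ s ≠ 0 → s ∈ R) (hπ : IsPolicy π) {s : S} (hs : M.stateVisit π s ≠ 0) :
    s ∈ R := by
  classical
  by_contra hsR
  set g : S → ℝ := fun s => if s ∈ R then 0 else 1
  have h := M.sum_stateVisit_flow hπ g
  have h0 : ∑ s, M.ρ s * g s = 0 := by
    refine Finset.sum_eq_zero fun x _ => ?_
    by_cases hx : x ∈ R
    · simp [g, hx]
    · rw [not_imp_comm.1 (hρ x) hx, zero_mul]
  rw [h0, mul_zero] at h
  have hnext : ∀ x, ∑ a, π x a * M.next g x a ≤ g x := by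
    intro x
    by_cases hx : x ∈ R
    · rw [show g x = 0 by simp [g, hx]]
      refine Finset.sum_nonpos fun a _ => mul_nonpos_of_nonneg_of_nonpos ((hπ x).1 a) ?_
      have := hR.next_le (f := g) (g := fun _ => 0) (c := 0) (fun s hs => by simp [g, hs]) hx a
      simpa [next_const] using this
    · have e : g x = ∑ a, π x a * 1 := by simp [g, hx, (hπ x).2]
      rw [e]
      refine Finset.sum_le_sum fun a _ => mul_le_mul_of_nonneg_left ?_ ((hπ x).1 a)
      have := M.isClosedSet_univ.next_le (f := g) (g := fun _ => 1) (c := 0)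
        (fun s _ => by simp only [g]; split_ifs <;> norm_num) (Set.mem_univ x) a
      simpa [next_const] using this
  have hγ := M.one_sub_γ_pos
  have hterm : ∀ x, M.stateVisit π x * ((1 - M.γ) * g x) ≤
      M.stateVisit π x * (g x - M.γ * ∑ a, π x a * M.next g x a) := fun x =>
    mul_le_mul_of_nonneg_left (by nlinarith [hnext x, M.γ_pos]) (M.stateVisit_nonneg hπ x)
  have hg0 : ∀ x, 0 ≤ g x := fun x => by simp only [g]; split_ifs <;> norm_num
  have h1 : M.stateVisit π s * ((1 - M.γ) * g s) ≤ 0 := by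
    calc _ ≤ ∑ x, M.stateVisit π x * ((1 - M.γ) * g x) :=
          Finset.single_le_sum (f := fun x => M.stateVisit π x * ((1 - M.γ) * g x))
            (fun x _ => mul_nonneg (M.stateVisit_nonneg hπ x) (mul_nonneg hγ.le (hg0 x)))
            (Finset.mem_univ s)
      _ ≤ _ := Finset.sum_le_sum fun x _ => hterm x
      _ = 0 := h
  have h2 : g s = 1 := by simp [g, hsR]
  have h3 : 0 < M.stateVisit π s := lt_of_le_of_ne (M.stateVisit_nonneg hπ s) (Ne.symm hs)
  rw [h2, mul_one] at h1
  nlinarith [mul_pos h3 hγ]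

variable [Nonempty A]

/-- A softmax policy plays every action with positive probability, so it follows every possible
transition. -/
theorem isClosedSet_visited (θ : S × A → ℝ) :
    M.IsClosedSet {s | M.stateVisit (softmax θ) s ≠ 0} := by
  intro s hs a s' hP
  have hπ := isPolicy_softmax θ
  have h := M.stateVisit_flow hπ s'
  have hs' : 0 < M.stateVisit (softmax θ) s := lt_of_le_of_ne (M.stateVisit_nonneg hπ s) (Ne.symm hs)
  have h1 : 0 < ∑ b, softmax θ s b * M.P s b s' :=
    Finset.sum_pos' (fun b _ => mul_nonneg (softmax_pos θ s b).le ((M.P_mem s b).1 s'))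
      ⟨a, Finset.mem_univ a, mul_pos (softmax_pos θ s a)
        (lt_of_le_of_ne ((M.P_mem s a).1 s') (Ne.symm hP))⟩
  have h2 : 0 < ∑ x, M.stateVisit (softmax θ) x * ∑ b, softmax θ x b * M.P x b s' :=
    Finset.sum_pos' (fun x _ => mul_nonneg (M.stateVisit_nonneg hπ x)
      (Finset.sum_nonneg fun b _ => mul_nonneg (softmax_pos θ x b).le ((M.P_mem x b).1 s')))
      ⟨s, Finset.mem_univ s, mul_pos hs' h1⟩
  have h3 := mul_nonneg M.one_sub_γ_pos.le (M.ρ_mem.1 s')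
  have h4 := mul_pos M.γ_pos h2
  exact (h ▸ (by linarith) : 0 < M.stateVisit (softmax θ) s').ne'

theorem visited_of_ρ_ne_zero (θ : S × A → ℝ) {s : S} (hs : M.ρ s ≠ 0) :
    M.stateVisit (softmax θ) s ≠ 0 := by
  have hπ := isPolicy_softmax θ
  have h1 : 0 < M.ρ s := lt_of_le_of_ne (M.ρ_mem.1 s) (Ne.symm hs)
  have h2 : 0 ≤ ∑ x, M.stateVisit (softmax θ) x * ∑ b, softmax θ x b * M.P x b s :=
    Finset.sum_nonneg fun x _ => mul_nonneg (M.stateVisit_nonneg hπ x)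
      (Finset.sum_nonneg fun b _ => mul_nonneg (softmax_pos θ x b).le ((M.P_mem x b).1 s))
  rw [M.stateVisit_flow hπ s]
  have := mul_pos M.one_sub_γ_pos h1
  have := mul_nonneg M.γ_pos.le h2
  linarith

/-- Softmax policies visit every state that some policy visits. -/
theorem stateVisit_softmax_ne_zero (θ : S × A → ℝ) (hπ : IsPolicy π) {s : S}
    (hs : M.stateVisit π s ≠ 0) : M.stateVisit (softmax θ) s ≠ 0 :=
  (M.isClosedSet_visited θ).mem_of_stateVisit_ne_zero (fun _ => M.visited_of_ρ_ne_zero θ) hπ hs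

theorem klVec_softmax_nonneg (hπ : IsPolicy π) (θ : S × A → ℝ) (s : S) :
    0 ≤ klVec (π s) (softmax θ s) :=
  klVec_nonneg (hπ s) (isPolicy_softmax θ s) (domBy_softmax _ _ _)

theorem klVec_softmax_self (θ : S × A → ℝ) (s : S) :
    klVec (softmax θ s) (softmax θ s) = 0 :=
  Finset.sum_eq_zero fun a _ => by rw [div_self (softmax_pos θ s a).ne']; simp

/-- One-step form of the three-point identity for a softmax policy proportional to
`π₀ * exp (q / α)`. -/
theorem sum_regReward_eq (hπ : IsPolicy π) {r : S → A → ℝ} {α c : ℝ} {θ₀ θ₁ : S × A → ℝ}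
    {f : S → ℝ} {s : S}
    (h : ∀ a, α * Real.log (softmax θ₁ s a / softmax θ₀ s a) = r s a + M.γ * M.next f s a - c) :
    ∑ a, π s a * (regReward r α (softmax θ₀) π s a + M.γ * M.next f s a) =
      c - α * klVec (π s) (softmax θ₁ s) := by
  have e : c - α * klVec (π s) (softmax θ₁ s) =
      ∑ a, (π s a * c - α * (π s a * Real.log (π s a / softmax θ₁ s a))) := by
    rw [Finset.sum_sub_distrib, ← Finset.sum_mul, (hπ s).2, one_mul, ← Finset.mul_sum, klVec]
  rw [e]
  refine Finset.sum_congr rfl fun a _ => ?_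
  rcases ((hπ s).1 a).eq_or_lt with h0 | h0
  · simp [← h0]
  · have h1 := h a
    have hp0 := (softmax_pos θ₀ s a).ne'
    have hp1 := (softmax_pos θ₁ s a).ne'
    rw [regReward, Real.log_div h0.ne' hp0, Real.log_div h0.ne' hp1]
    rw [Real.log_div hp1 hp0] at h1
    linear_combination π s a * (-h1)

section InnerLoop

variable {r : S → A → ℝ} {α L : ℝ} {θ₀ : S × A → ℝ}

/-- The regularized state values of the policies produced by the inner loop. -/
def innerValue (M : MOMDP S A m) (r : S → A → ℝ) (α : ℝ) (θ₀ : S × A → ℝ) (j : ℕ) : S → ℝ :=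
  (M.exists_isValueFun (regReward r α (softmax θ₀)
    (softmax (M.innerLoop θ₀ r α ((1 - M.γ) / α) j)))
    (isPolicy_softmax (M.innerLoop θ₀ r α ((1 - M.γ) / α) j))).choose

theorem innerValue_spec (j : ℕ) : M.IsValueFun (regReward r α (softmax θ₀)
    (softmax (M.innerLoop θ₀ r α ((1 - M.γ) / α) j)))
    (softmax (M.innerLoop θ₀ r α ((1 - M.γ) / α) j)) (M.innerValue r α θ₀ j) :=
  (M.exists_isValueFun _ (isPolicy_softmax _)).choose_spec

/-- All softmax policies visit the same states, so the soft policy iteration formula holds on a set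
independent of `j`. By `sum_regReward_eq`, `c` is there the soft Bellman optimum for the values of
the `j`-th iterate. -/
theorem exists_bellman (hα : 0 < α) (j : ℕ) : ∃ c : S → ℝ,
    ∀ s, M.stateVisit (softmax θ₀) s ≠ 0 → ∀ a,
      α * Real.log (softmax (M.innerLoop θ₀ r α ((1 - M.γ) / α) (j + 1)) s a /
        softmax θ₀ s a) = r s a + M.γ * M.next (M.innerValue r α θ₀ j) s a - c s := by
  have h : ∀ s, ∃ c : ℝ, M.stateVisit (softmax θ₀) s ≠ 0 → ∀ a,
      α * Real.log (softmax (M.innerLoop θ₀ r α ((1 - M.γ) / α) (j + 1)) s a /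
        softmax θ₀ s a) = r s a + M.γ * M.next (M.innerValue r α θ₀ j) s a - c := by
    intro s
    by_cases hs : M.stateVisit (softmax θ₀) s = 0
    · exact ⟨0, fun h => absurd hs h⟩
    · obtain ⟨c, hc⟩ := npg_step_of_visited hα (innerValue_spec (M := M) (r := r) (θ₀ := θ₀) j)
        (stateVisit_softmax_ne_zero _ (isPolicy_softmax θ₀) hs)
      exact ⟨c, fun _ => hc⟩
  choose c hc using h
  exact ⟨c, hc⟩

theorem next_sum_le {R : Set S} (hR : M.IsClosedSet R) (hπ : IsPolicy π) {q : A → ℝ}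
    {f g : S → ℝ} {e : ℝ} (h : ∀ s ∈ R, f s ≤ g s + e) {s : S} (hs : s ∈ R) :
    ∑ a, π s a * (q a + M.γ * M.next f s a) ≤
      ∑ a, π s a * (q a + M.γ * M.next g s a) + M.γ * e := by
  have e1 : M.γ * e = ∑ a, π s a * (M.γ * e) := by rw [← Finset.sum_mul, (hπ s).2, one_mul]
  rw [e1, ← Finset.sum_add_distrib]
  refine Finset.sum_le_sum fun a _ => ?_
  rw [← mul_add, add_assoc, ← mul_add]
  have := hR.next_le h hs a
  have := M.γ_pos.le
  refine mul_le_mul_of_nonneg_left ?_ ((hπ s).1 a)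
  gcongr

/-- Soft policy iteration improves the soft Bellman image `c` of the current values. -/
theorem innerValue_improve (hα : 0 < α) {j : ℕ} {c : S → ℝ}
    (hc : ∀ s, M.stateVisit (softmax θ₀) s ≠ 0 → ∀ a,
      α * Real.log (softmax (M.innerLoop θ₀ r α ((1 - M.γ) / α) (j + 1)) s a /
        softmax θ₀ s a) = r s a + M.γ * M.next (M.innerValue r α θ₀ j) s a - c s) {s : S}
    (hs : M.stateVisit (softmax θ₀) s ≠ 0) :
    M.innerValue r α θ₀ j s ≤ c s ∧ c s ≤ M.innerValue r α θ₀ (j + 1) s := by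
  set R : Set S := {s | M.stateVisit (softmax θ₀) s ≠ 0}
  have hR : M.IsClosedSet R := M.isClosedSet_visited θ₀
  set θj := M.innerLoop θ₀ r α ((1 - M.γ) / α) j
  set θk := M.innerLoop θ₀ r α ((1 - M.γ) / α) (j + 1)
  set f := M.innerValue r α θ₀ j
  set f' := M.innerValue r α θ₀ (j + 1)
  have hπj : IsPolicy (softmax θj) := isPolicy_softmax θj
  have hπk : IsPolicy (softmax θk) := isPolicy_softmax θk
  have h1 : ∀ s ∈ R, f s ≤ c s := by
    intro s hs
    rw [show f s = _ from innerValue_spec j s, sum_regReward_eq hπj (hc s hs)]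
    have := mul_nonneg hα.le (klVec_softmax_nonneg hπj θk s)
    linarith
  have h2 : ∀ s ∈ R, c s =
      ∑ a, softmax θk s a * (regReward r α (softmax θ₀) (softmax θk) s a + M.γ * M.next f s a) := by
    intro s hs
    rw [sum_regReward_eq hπk (hc s hs)]
    rw [klVec_softmax_self, mul_zero, sub_zero]
  have h3 : ∀ s ∈ R, f s ≤ f' s := by
    have := hR.le_of_sub_le hπk (f := f) (g := f') (c := 0) fun s hs => by
      have e : M.γ * ∑ a, softmax θk s a * (M.next f s a - M.next f' s a) = c s - f' s := by
        rw [h2 s hs, show f' s = _ from innerValue_spec (j + 1) s, ← Finset.sum_sub_distrib,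
          Finset.mul_sum]
        exact Finset.sum_congr rfl fun a _ => by ring
      rw [e]
      linarith [h1 s hs]
    simpa using this
  refine ⟨h1 s hs, ?_⟩
  have h4 := next_sum_le hR hπk (q := regReward r α (softmax θ₀) (softmax θk) s)
    (f := f) (g := f') (e := 0) (fun s hs => by simpa using h3 s hs) hs
  rw [← h2 s hs, mul_zero, add_zero] at h4
  exact h4.trans (le_of_eq (innerValue_spec (j + 1) s).symm)

theorem regReward_self (π₀ : S → A → ℝ) (h : ∀ s a, π₀ s a ≠ 0) :
    regReward r α π₀ π₀ = r := by
  funext s a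
  rw [regReward, div_self (h s a), Real.log_one, mul_zero, sub_zero]

/-- Induction on `j`: replacing `g` by the current values inside the Bellman equation of `g` costs a
factor `γ` of the error, the result is at most `c`, and `c` is at most the next values. For `j = 0`
the iterate is the anchor and pays no penalty, so only the range of the rewards matters. -/
theorem innerValue_contract (hα : 0 < α) {lo : ℝ} (hr : ∀ s a, lo ≤ r s a ∧ r s a ≤ lo + L)
    {θ : S × A → ℝ} {g : S → ℝ}
    (hg : M.IsValueFun (regReward r α (softmax θ₀) (softmax θ)) (softmax θ) g) (j : ℕ) :
    ∀ s, M.stateVisit (softmax θ₀) s ≠ 0 →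
      g s ≤ M.innerValue r α θ₀ j s + M.γ ^ j * (L / (1 - M.γ)) := by
  set R : Set S := {s | M.stateVisit (softmax θ₀) s ≠ 0}
  have hR : M.IsClosedSet R := M.isClosedSet_visited θ₀
  have hπ : IsPolicy (softmax θ) := isPolicy_softmax θ
  induction j with
  | zero =>
    have hf := innerValue_spec (M := M) (r := r) (α := α) (θ₀ := θ₀) 0
    have h0 : M.innerLoop θ₀ r α ((1 - M.γ) / α) 0 = θ₀ := rfl
    rw [h0, regReward_self _ fun s a => (softmax_pos θ₀ s a).ne'] at hf
    have hπ₀ : IsPolicy (softmax θ₀) := isPolicy_softmax θ₀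
    intro s hs
    have h1 := hf.ge_of_ge hR hπ₀ (c := lo) (fun s _ => by
      rw [← one_mul lo, ← (hπ₀ s).2, Finset.sum_mul]
      exact Finset.sum_le_sum fun a _ => mul_le_mul_of_nonneg_left (hr s a).1 ((hπ₀ s).1 a)) s hs
    have h2 := hg.le_of_le hR hπ (c := lo + L) (fun s _ => by
      rw [sum_mul_regReward]
      have h3 := mul_nonneg hα.le (klVec_softmax_nonneg hπ θ₀ s)
      have h4 : ∑ a, softmax θ s a * r s a ≤ lo + L := by
        rw [← one_mul (lo + L), ← (hπ s).2, Finset.sum_mul]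
        exact Finset.sum_le_sum fun a _ => mul_le_mul_of_nonneg_left (hr s a).2 ((hπ s).1 a)
      linarith) s hs
    rw [add_div] at h2
    rw [pow_zero, one_mul]
    linarith
  | succ j ih =>
    intro s hs
    obtain ⟨c, hc⟩ := exists_bellman (M := M) (r := r) (θ₀ := θ₀) hα j
    have h1 := next_sum_le hR hπ (q := regReward r α (softmax θ₀) (softmax θ) s) ih hs
    rw [← hg s, sum_regReward_eq hπ (hc s hs)] at h1
    have h2 := mul_nonneg hα.le (klVec_softmax_nonneg hπ
      (M.innerLoop θ₀ r α ((1 - M.γ) / α) (j + 1)) s)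
    have h3 := (innerValue_improve hα hc hs).2
    rw [pow_succ']
    rw [← mul_assoc] at h1
    linarith

/-- The value of `π` regularized towards `π_{θ₀}`. -/
def anchoredValue (M : MOMDP S A m) (r : S → A → ℝ) (α : ℝ) (θ₀ : S × A → ℝ)
    (π : S → A → ℝ) : ℝ :=
  M.value r π - α / (1 - M.γ) * ∑ s, M.stateVisit π s * klVec (π s) (softmax θ₀ s)

theorem anchoredValue_eq (hπ : IsPolicy π) :
    M.anchoredValue r α θ₀ π = M.value (regReward r α (softmax θ₀) π) π := by
  rw [value_regReward hπ, anchoredValue, div_mul_eq_mul_div]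

theorem three_point_succ (hα : 0 < α) {lo : ℝ} (hr : ∀ s a, lo ≤ r s a ∧ r s a ≤ lo + L)
    (n : ℕ) (hπ : IsPolicy π) :
    M.anchoredValue r α θ₀ π + α / (1 - M.γ) * ∑ s, M.stateVisit π s *
        klVec (π s) (softmax (M.innerLoop θ₀ r α ((1 - M.γ) / α) (n + 1)) s) ≤
      M.anchoredValue r α θ₀ (softmax (M.innerLoop θ₀ r α ((1 - M.γ) / α) (n + 1))) +
        M.γ ^ n * (L / (1 - M.γ) ^ 2) := by
  obtain ⟨c, hc⟩ := exists_bellman (M := M) (r := r) (θ₀ := θ₀) hα n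
  set θ₁ := M.innerLoop θ₀ r α ((1 - M.γ) / α) (n + 1) with hθ₁
  set f := M.innerValue r α θ₀ n
  have hγ := M.one_sub_γ_pos
  -- An exact identity with baseline `f`: adding the KL term to the new policy cancels all
  -- dependence on `p` except the visitation average of `c - f`. Since `c - f` lies between 0 and
  -- the geometric error, comparing `p = π` with the new policy gives the claim.
  have key : ∀ {p : S → A → ℝ}, IsPolicy p →
      M.anchoredValue r α θ₀ p + α / (1 - M.γ) * ∑ s, M.stateVisit p s *
        klVec (p s) (softmax θ₁ s) =
      ∑ s, M.ρ s * f s + (∑ s, M.stateVisit p s * (c s - f s)) / (1 - M.γ) := by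
    intro p hp
    rw [anchoredValue_eq hp, ← sub_eq_iff_eq_add', add_sub_right_comm, value_sub_baseline hp,
      div_mul_eq_mul_div, ← add_div, Finset.mul_sum, ← Finset.sum_add_distrib]
    congr 1
    refine Finset.sum_congr rfl fun s _ => ?_
    by_cases hs : M.stateVisit p s = 0
    · simp [hs]
    · rw [sum_regReward_eq hp (hc s (stateVisit_softmax_ne_zero θ₀ hp hs))]
      ring
  have himp : ∀ s, M.stateVisit (softmax θ₀) s ≠ 0 → f s ≤ c s ∧
      c s ≤ f s + M.γ ^ n * (L / (1 - M.γ)) := fun s hs => by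
    have h1 := innerValue_improve hα hc hs
    -- The comparator of the contraction is the next iterate itself: `c` is below its value, which
    -- exceeds `f` by at most the geometric error.
    exact ⟨h1.1, h1.2.trans (innerValue_contract hα hr (innerValue_spec (n + 1)) n s hs)⟩
  have hlow := key (isPolicy_softmax θ₁)
  simp only [klVec_softmax_self, mul_zero, Finset.sum_const_zero, add_zero] at hlow
  have h0 : 0 ≤ (∑ s, M.stateVisit (softmax θ₁) s * (c s - f s)) / (1 - M.γ) := by
    refine div_nonneg (Finset.sum_nonneg fun s _ => ?_) hγ.le
    by_cases hs : M.stateVisit (softmax θ₁) s = 0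
    · simp [hs]
    · exact mul_nonneg (M.stateVisit_nonneg (isPolicy_softmax θ₁) s) (sub_nonneg.2
        (himp s (stateVisit_softmax_ne_zero θ₀ (isPolicy_softmax θ₁) hs)).1)
  have h1 : (∑ s, M.stateVisit π s * (c s - f s)) / (1 - M.γ) ≤
      M.γ ^ n * (L / (1 - M.γ) ^ 2) := by
    have : M.γ ^ n * (L / (1 - M.γ) ^ 2) = M.γ ^ n * (L / (1 - M.γ)) / (1 - M.γ) := by
      field_simp
    rw [this]
    refine div_le_div_of_nonneg_right ?_ hγ.le
    have e : M.γ ^ n * (L / (1 - M.γ)) =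
        ∑ s, M.stateVisit π s * (M.γ ^ n * (L / (1 - M.γ))) := by
      rw [← Finset.sum_mul, (M.stateVisit_mem hπ).2, one_mul]
    rw [e]
    refine Finset.sum_le_sum fun s _ => ?_
    by_cases hs : M.stateVisit π s = 0
    · simp [hs]
    · exact mul_le_mul_of_nonneg_left
        (by linarith [(himp s (stateVisit_softmax_ne_zero θ₀ hπ hs)).2])
        (M.stateVisit_nonneg hπ s)
  rw [key hπ, hlow]
  linarith

theorem value_le_add {lo : ℝ} (hr : ∀ s a, lo ≤ r s a ∧ r s a ≤ lo + L) (hπ : IsPolicy π)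
    (hπ' : IsPolicy π') : M.value r π ≤ M.value r π' + L / (1 - M.γ) := by
  have hγ := M.one_sub_γ_pos
  have h1 : ∑ s, M.stateVisit π s * ∑ a, π s a * r s a ≤ lo + L := by
    rw [← one_mul (lo + L), ← (M.stateVisit_mem hπ).2, Finset.sum_mul]
    refine Finset.sum_le_sum fun s _ => mul_le_mul_of_nonneg_left ?_ (M.stateVisit_nonneg hπ s)
    rw [← one_mul (lo + L), ← (hπ s).2, Finset.sum_mul]
    exact Finset.sum_le_sum fun a _ => mul_le_mul_of_nonneg_left (hr s a).2 ((hπ s).1 a)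
  have h2 : lo ≤ ∑ s, M.stateVisit π' s * ∑ a, π' s a * r s a := by
    rw [← one_mul lo, ← (M.stateVisit_mem hπ').2, Finset.sum_mul]
    refine Finset.sum_le_sum fun s _ => mul_le_mul_of_nonneg_left ?_ (M.stateVisit_nonneg hπ' s)
    rw [← one_mul lo, ← (hπ' s).2, Finset.sum_mul]
    exact Finset.sum_le_sum fun a _ => mul_le_mul_of_nonneg_left (hr s a).1 ((hπ' s).1 a)
  rw [value_eq hπ, value_eq hπ', ← add_div]
  exact div_le_div_of_nonneg_right (by linarith) hγ.le

/-- The approximate three-point inequality satisfied by the output of the inner loop. -/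
theorem three_point (hα : 0 < α) (hL : 0 ≤ L) {lo : ℝ}
    (hr : ∀ s a, lo ≤ r s a ∧ r s a ≤ lo + L) (n : ℕ) (hπ : IsPolicy π) :
    M.anchoredValue r α θ₀ π + α / (1 - M.γ) * ∑ s, M.stateVisit π s *
        klVec (π s) (softmax (M.innerLoop θ₀ r α ((1 - M.γ) / α) n) s) ≤
      M.anchoredValue r α θ₀ (softmax (M.innerLoop θ₀ r α ((1 - M.γ) / α) n)) +
        Real.exp (-((1 - M.γ) * (n - 1))) * (L / (1 - M.γ) ^ 2) := by
  have hγ := M.one_sub_γ_pos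
  cases n with
  -- Without iterations the output is the anchor. The exponential factor is then at least 1, so the
  -- range of the values is enough.
  | zero =>
    have h0 : M.innerLoop θ₀ r α ((1 - M.γ) / α) 0 = θ₀ := rfl
    rw [h0]
    simp only [anchoredValue, klVec_softmax_self, mul_zero, Finset.sum_const_zero, sub_zero,
      sub_add_cancel]
    refine (value_le_add hr hπ (isPolicy_softmax θ₀)).trans ?_
    have h1 : (1 : ℝ) ≤ Real.exp (-((1 - M.γ) * ((0 : ℕ) - 1))) :=
      Real.one_le_exp (by push_cast; linarith)
    have h2 : L / (1 - M.γ) ≤ L / (1 - M.γ) ^ 2 := by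
      refine div_le_div_of_nonneg_left hL (by positivity) ?_
      nlinarith [M.γ_pos]
    have h3 := mul_le_mul_of_nonneg_right h1 (div_nonneg hL (pow_nonneg hγ.le 2))
    rw [one_mul] at h3
    linarith
  | succ n =>
    refine (three_point_succ hα hr n hπ).trans ?_
    gcongr
    have h1 : M.γ ≤ Real.exp (-(1 - M.γ)) := by
      have := Real.add_one_le_exp (-(1 - M.γ))
      linarith
    calc M.γ ^ n ≤ Real.exp (-(1 - M.γ)) ^ n := pow_le_pow_left₀ M.γ_pos.le h1 n
      _ = _ := by rw [← Real.exp_nat_mul]; congr 1; push_cast; ring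

end InnerLoop

theorem policy_eq_of_card_eq_one (h : Fintype.card A = 1) (hπ : IsPolicy π) (hπ' : IsPolicy π') :
    π = π' := by
  obtain ⟨x, hx⟩ := Fintype.card_eq_one_iff.1 h
  have : ∀ {p : S → A → ℝ}, IsPolicy p → ∀ s a, p s a = 1 := fun {p} hp s a => by
    rw [← (hp s).2, Finset.sum_eq_single a]
    · intro b _ hb; exact absurd ((hx b).trans (hx a).symm) hb
    · simp
  funext s a
  rw [this hπ, this hπ']

/-- Measured from the sum of the negative parts of `G`, the scalarized reward has range of width at
most `L`; a bound on its absolute value would only give `2L`. -/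
theorem dirReward_bounds (G : Fin m → ℝ) {L : ℝ} (hG : l1norm G ≤ L) (s : S) (a : A) :
    ∑ i, min (G i) 0 ≤ M.dirReward G s a ∧
      M.dirReward G s a ≤ ∑ i, min (G i) 0 + L := by
  constructor
  · refine Finset.sum_le_sum fun i _ => ?_
    obtain ⟨h0, h1⟩ := M.r_mem i s a
    rcases le_total (G i) 0 with h | h
    · rw [min_eq_left h]; nlinarith
    · rw [min_eq_right h]; positivity
  · refine le_trans ?_ (add_le_add_right hG _)
    rw [l1norm, ← Finset.sum_add_distrib]
    refine Finset.sum_le_sum fun i _ => ?_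
    obtain ⟨h0, h1⟩ := M.r_mem i s a
    rcases le_total (G i) 0 with h | h
    · rw [min_eq_left h, abs_of_nonpos h]; nlinarith
    · rw [min_eq_right h, abs_of_nonneg h]; nlinarith

/-- The three-point inequality with the prescribed number of inner iterations. -/
theorem three_point_dirReward {α β L : ℝ} {K n : ℕ} {θ₀ : S × A → ℝ} {G : Fin m → ℝ} (hβ : 0 < β)
    (hα : 6 * β / (1 - M.γ) ^ 3 ≤ α) (hL : 0 < L) (hG : l1norm G ≤ L) (hK : 1 ≤ K)
    (hn : n = ⌈1 / (1 - M.γ) *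
      Real.log (5 * L * K / (6 * β * Real.log (Fintype.card A))) + 1⌉₊) (hπ : IsPolicy π) :
    M.anchoredValue (M.dirReward G) α θ₀ π + α / (1 - M.γ) * ∑ s, M.stateVisit π s *
        klVec (π s) (softmax (M.innerLoop θ₀ (M.dirReward G) α ((1 - M.γ) / α) n) s) ≤
      M.anchoredValue (M.dirReward G) α θ₀
        (softmax (M.innerLoop θ₀ (M.dirReward G) α ((1 - M.γ) / α) n)) +
        α / (1 - M.γ) * Real.log (Fintype.card A) / K := by
  have hγ := M.one_sub_γ_pos
  have hα0 : 0 < α := lt_of_lt_of_le (by positivity) hα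
  have hK0 : (0 : ℝ) < K := by exact_mod_cast hK
  rcases (Nat.succ_le_of_lt (Fintype.card_pos (α := A))).eq_or_lt with hA | hA
  -- With a single action `log|A| = 0` and the iteration count is meaningless, but there is only one
  -- policy and both sides agree.
  · set θ₁ := M.innerLoop θ₀ (M.dirReward G) α ((1 - M.γ) / α) n
    rw [policy_eq_of_card_eq_one hA.symm hπ (isPolicy_softmax θ₁), ← hA]
    simp [klVec_softmax_self]
  · have hlog : 0 < Real.log (Fintype.card A) := Real.log_pos (by exact_mod_cast hA)
    refine (three_point hα0 hL.le (dirReward_bounds G hG) n hπ).trans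
      (add_le_add_right ?_ _)
    set X := 5 * L * K / (6 * β * Real.log (Fintype.card A)) with hX
    have hX0 : 0 < X := by positivity
    have h1 : 1 / (1 - M.γ) * Real.log X + 1 ≤ n := hn ▸ Nat.le_ceil _
    have h2 : Real.log X ≤ (1 - M.γ) * (n - 1) := by
      have : 1 / (1 - M.γ) * Real.log X ≤ n - 1 := by linarith
      rwa [one_div, inv_mul_le_iff₀ hγ] at this
    have h3 : Real.exp (-((1 - M.γ) * (n - 1))) ≤ X⁻¹ := by
      rw [← Real.exp_log (inv_pos.2 hX0), Real.log_inv]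
      exact Real.exp_le_exp.2 (neg_le_neg h2)
    have h4 : 6 * β ≤ α * (1 - M.γ) ^ 3 := (div_le_iff₀ (by positivity)).1 hα
    calc _ ≤ X⁻¹ * (L / (1 - M.γ) ^ 2) := by gcongr
      _ = 6 * β * Real.log (Fintype.card A) / (5 * K * (1 - M.γ) ^ 2) := by
          rw [hX]; field_simp
      _ ≤ α * (1 - M.γ) ^ 3 * Real.log (Fintype.card A) / (5 * K * (1 - M.γ) ^ 2) := by gcongr
      _ = α * Real.log (Fintype.card A) / K * ((1 - M.γ) / 5) := by field_simp
      -- The constant 5 leaves slack: only `(1 - γ) ^ 2 ≤ 5` is needed.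
      _ ≤ α * Real.log (Fintype.card A) / K * (1 / (1 - M.γ)) := by
          refine mul_le_mul_of_nonneg_left ?_ (by positivity)
          rw [div_le_div_iff₀ (by norm_num) hγ]
          nlinarith [M.γ_pos]
      _ = _ := by field_simp

end MOMDP

end

/-! ### Analysis of the optimistic mirror descent ascent run -/

section Aux

variable {ι : Type*} [Fintype ι]

theorem l1norm_nonneg (x : ι → ℝ) : 0 ≤ l1norm x := Finset.sum_nonneg fun _ _ => abs_nonneg _

theorem l1norm_sub_comm (x y : ι → ℝ) : l1norm (x - y) = l1norm (y - x) :=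
  Finset.sum_congr rfl fun _ _ => abs_sub_comm _ _

theorem l1norm_sub_le (x y z : ι → ℝ) : l1norm (x - z) ≤ l1norm (x - y) + l1norm (y - z) := by
  rw [l1norm, l1norm, l1norm, ← Finset.sum_add_distrib]
  exact Finset.sum_le_sum fun i _ => abs_sub_le _ _ _

theorem dotProduct_le_l1norm_mul_norm (x y : ι → ℝ) : x ⬝ᵥ y ≤ l1norm x * ‖y‖ := by
  rw [l1norm, Finset.sum_mul]
  refine Finset.sum_le_sum fun i _ => (le_abs_self _).trans ?_
  rw [abs_mul]
  exact mul_le_mul_of_nonneg_left (norm_le_pi_norm y i) (abs_nonneg _)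

theorem dotProduct_le_norm_mul_l1norm (x y : ι → ℝ) : x ⬝ᵥ y ≤ ‖x‖ * l1norm y := by
  rw [dotProduct_comm, mul_comm]
  exact dotProduct_le_l1norm_mul_norm y x

theorem ConvexOn.add_fderiv_le {E : Type*} [NormedAddCommGroup E] [NormedSpace ℝ E] {C : Set E}
    {f : E → ℝ} (hf : ConvexOn ℝ C f) {x y : E} (hx : x ∈ C) (hy : y ∈ C)
    (hd : DifferentiableAt ℝ f x) : f x + fderiv ℝ f x (y - x) ≤ f y := by
  have h1 : HasDerivAt (fun t : ℝ => f (x + t • (y - x))) (fderiv ℝ f x (y - x)) 0 := by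
    have hl : HasDerivAt (fun t : ℝ => x + t • (y - x)) (y - x) 0 := by
      simpa using ((hasDerivAt_id (0 : ℝ)).smul_const (y - x)).const_add x
    have hd' : HasFDerivAt f (fderiv ℝ f x) (x + (0 : ℝ) • (y - x)) := by
      simpa using hd.hasFDerivAt
    exact hd'.comp_hasDerivAt 0 hl
  have h2 := h1.tendsto_slope_zero_right
  have h3 : fderiv ℝ f x (y - x) ≤ f y - f x := by
    refine le_of_tendsto h2 ?_
    have hlt : ∀ᶠ t : ℝ in nhdsWithin 0 (Set.Ioi 0), t < 1 :=
      (eventually_lt_nhds one_pos).filter_mono nhdsWithin_le_nhds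
    filter_upwards [hlt, self_mem_nhdsWithin] with t ht1 ht0
    have ht0' : (0 : ℝ) < t := ht0
    have h4 := hf.2 hx hy (sub_nonneg.2 ht1.le) ht0'.le (by ring)
    have e : (1 - t) • x + t • y = x + t • (y - x) := by module
    rw [e] at h4
    simp only [smul_eq_mul] at h4
    simp only [zero_add, zero_smul, add_zero, smul_eq_mul]
    rw [inv_mul_le_iff₀ ht0']
    linarith
  linarith

theorem ConcaveOn.le_add_fderiv {E : Type*} [NormedAddCommGroup E] [NormedSpace ℝ E] {C : Set E}
    {f : E → ℝ} (hf : ConcaveOn ℝ C f) {x y : E} (hx : x ∈ C) (hy : y ∈ C)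
    (hd : DifferentiableAt ℝ f x) : f y ≤ f x + fderiv ℝ f x (y - x) := by
  have h := hf.neg.add_fderiv_le hx hy hd.neg
  rw [fderiv_neg] at h
  simp only [Pi.neg_apply, neg_apply] at h
  linarith

/-- The quadratic terms of one optimistic step are absorbed, up to a telescoping difference. -/
theorem optimistic_step_le {β u w a b P Q P₀ p q p₀ : ℝ} (hβ : 0 ≤ β) (hu : 0 ≤ u) (hw : 0 ≤ w)
    (hP : 0 ≤ P) (hp : 0 ≤ p) (huw : u + w ≤ β * (a + b)) (ha : a ≤ Q + P₀) (hb : b ≤ q + p₀) :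
    u * P + w * p - 3 * β * (P ^ 2 + Q ^ 2 + p ^ 2 + q ^ 2) ≤
      2 * β * (P₀ ^ 2 + p₀ ^ 2) - 2 * β * (P ^ 2 + p ^ 2) := by
  have h1 : u * P + w * p ≤ (u + w) * (P + p) := by nlinarith [mul_nonneg hu hp, mul_nonneg hw hP]
  have h2 : (u + w) * (P + p) ≤ β * (Q + P₀ + (q + p₀)) * (P + p) := by
    refine mul_le_mul_of_nonneg_right (huw.trans ?_) (by positivity)
    exact mul_le_mul_of_nonneg_left (by linarith) hβ
  -- The weights 2 and 1 fit the telescoping: against `3β` of each square, the terms in `P` and `p`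
  -- keep `-2β`, matching the `2β` on `P₀` and `p₀` from the previous step.
  have h3 : (Q + P₀ + (q + p₀)) * (P + p) ≤
      2 * (Q ^ 2 + P₀ ^ 2 + q ^ 2 + p₀ ^ 2) + (P ^ 2 + p ^ 2) := by
    have i1 := sq_nonneg (Q + P₀ + (q + p₀) - (P + p))
    have i2 := sq_nonneg (P - p)
    have i3 := sq_nonneg (Q - P₀)
    have i4 := sq_nonneg (q - p₀)
    have i5 := sq_nonneg (Q - q)
    have i6 := sq_nonneg (Q - p₀)
    have i7 := sq_nonneg (P₀ - q)
    have i8 := sq_nonneg (P₀ - p₀)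
    nlinarith
  have h4 := mul_le_mul_of_nonneg_left h3 hβ
  have h5 := mul_nonneg hβ (add_nonneg (sq_nonneg Q) (sq_nonneg q))
  nlinarith

theorem uniform_mem_stdSimplex [Nonempty ι] :
    (fun _ => 1 / (Fintype.card ι : ℝ)) ∈ stdSimplex ℝ ι := by
  have : (Fintype.card ι : ℝ) ≠ 0 := by simp
  exact ⟨fun _ => by positivity, by simp [this]⟩

end Aux

namespace MOMDP

variable {S A : Type*} [Fintype S] [Fintype A] [DecidableEq S] [DecidableEq A] {m : ℕ}
  {M : MOMDP S A m} {π : S → A → ℝ}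

theorem value_dirReward (hπ : IsPolicy π) (G : Fin m → ℝ) :
    M.value (M.dirReward G) π = G ⬝ᵥ M.valueVec π := by
  simp only [dotProduct, valueVec, value_eq hπ, dirReward, mul_div_assoc']
  rw [← Finset.sum_div]
  congr 1
  simp only [Finset.mul_sum]
  conv_rhs => rw [Finset.sum_comm]
  refine Finset.sum_congr rfl fun s _ => ?_
  conv_rhs => rw [Finset.sum_comm]
  refine Finset.sum_congr rfl fun a _ => Finset.sum_congr rfl fun i _ => ?_
  ring

theorem anchoredValue_dirReward (hπ : IsPolicy π) (G : Fin m → ℝ) (α : ℝ) (θ₀ : S × A → ℝ) :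
    M.anchoredValue (M.dirReward G) α θ₀ π = G ⬝ᵥ M.valueVec π -
      α / (1 - M.γ) * ∑ s, M.stateVisit π s * klVec (π s) (softmax θ₀ s) := by
  rw [anchoredValue, value_dirReward hπ]

variable [Nonempty A]

/-- The lower bound on `α` makes the policy divergence strongly convex in the values with the
modulus that `η' ≤ 1 / (6β)` gives the `lam`-player. -/
theorem valueVec_sq_le_kl {α β : ℝ} (hα : 6 * β / (1 - M.γ) ^ 3 ≤ α) (hπ : IsPolicy π)
    (hβ : 0 < β) (θ : S × A → ℝ) :
    3 * β * ‖M.valueVec π - M.valueVec (softmax θ)‖ ^ 2 ≤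
      α / (1 - M.γ) * ∑ s, M.stateVisit π s * klVec (π s) (softmax θ s) := by
  have hγ := M.one_sub_γ_pos
  have h := M.norm_valueVec_sub_sq_le hπ (isPolicy_softmax θ) fun s => domBy_softmax _ _ _
  set D := ∑ s, M.stateVisit π s * klVec (π s) (softmax θ s)
  have hD : 0 ≤ D := Finset.sum_nonneg fun s _ =>
    mul_nonneg (M.stateVisit_nonneg hπ s) (klVec_softmax_nonneg hπ θ s)
  calc _ ≤ 3 * β * (2 * D / (1 - M.γ) ^ 4) := by gcongr
    _ = 6 * β / (1 - M.γ) ^ 3 / (1 - M.γ) * D := by field_simp; ring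
    _ ≤ _ := by gcongr

end MOMDP

/-! ### Regret of the optimistic run -/

section Run

variable {S A : Type*} [Fintype S] [Fintype A] [DecidableEq S] [DecidableEq A] [Nonempty A] {m : ℕ}
  {M : MOMDP S A m} {Φ : (Fin m → ℝ) → (Fin m → ℝ) → ℝ} {Λ : Set (Fin m → ℝ)}
  {α β L η η' : ℝ} {K : ℕ} {t : ℕ → ℕ} {θ θ' : ℕ → S × A → ℝ} {lam lam' : ℕ → Fin m → ℝ}

namespace IsOMDARun

/-- Membership is only in the simplex because the uniform start need not lie in `Λ`. -/
theorem lam_mem (hrun : IsOMDARun M Φ Λ α η η' K t θ θ' lam lam')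
    (hΛ : Λ ⊆ stdSimplex ℝ (Fin m)) (hm : Nonempty (Fin m)) {k : ℕ} (hk : k ≤ K) :
    lam k ∈ stdSimplex ℝ (Fin m) := by
  cases k with
  | zero => rw [hrun.init_lam]; simpa using uniform_mem_stdSimplex (ι := Fin m)
  | succ k => exact hΛ (hrun.step_lam k hk).mem

theorem lam'_mem (hrun : IsOMDARun M Φ Λ α η η' K t θ θ' lam lam')
    (hΛ : Λ ⊆ stdSimplex ℝ (Fin m)) (hm : Nonempty (Fin m)) {k : ℕ} (hk : k ≤ K) :
    lam' k ∈ stdSimplex ℝ (Fin m) := by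
  cases k with
  | zero => rw [hrun.init_lam']; simpa using uniform_mem_stdSimplex (ι := Fin m)
  | succ k => exact hΛ (hrun.step_lam' k hk).mem

theorem domBy_lam (hrun : IsOMDARun M Φ Λ α η η' K t θ θ' lam lam') (hη' : 0 < η')
    (hΛ : Λ ⊆ stdSimplex ℝ (Fin m)) (hconv : Convex ℝ Λ) (hm : Nonempty (Fin m))
    {μ : Fin m → ℝ} (hμ : μ ∈ Λ) {k : ℕ} (hk : k ≤ K) : DomBy μ (lam k) := by
  induction k with
  | zero =>
    intro i hi
    rw [hrun.init_lam] at hi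
    have : (m : ℝ) ≠ 0 := by
      have := Fin.pos (Classical.arbitrary (Fin m))
      positivity
    exact absurd hi (one_div_ne_zero this)
  | succ k ih =>
    exact (hrun.step_lam k hk).domBy_of_mem hη' hΛ hconv
      (hrun.lam_mem hΛ hm (Nat.le_of_succ_le hk)).1 hμ (ih (Nat.le_of_succ_le hk))

/-- The regret of the two policy updates of one macro step. -/
theorem policy_step (hrun : IsOMDARun M Φ Λ α η η' K t θ θ' lam lam') (hβ : 0 < β)
    (hα : 6 * β / (1 - M.γ) ^ 3 ≤ α) (hη : η = (1 - M.γ) / α) (hL : 0 < L) (hK : 1 ≤ K)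
    (hL_bound : ∀ k ≤ K, l1norm (gradV Φ (M.valueVec (softmax (θ' k))) (lam' k)) ≤ L)
    (ht : ∀ k, t k = ⌈1 / (1 - M.γ) *
      Real.log (5 * L * K / (6 * β * Real.log (Fintype.card A))) + 1⌉₊)
    {p : S → A → ℝ} (hp : IsPolicy p) {k : ℕ} (hk : k < K) :
    gradV Φ (M.valueVec (softmax (θ' (k + 1)))) (lam' (k + 1)) ⬝ᵥ
        (M.valueVec p - M.valueVec (softmax (θ' (k + 1)))) ≤
      α / (1 - M.γ) * ∑ s, M.stateVisit p s * klVec (p s) (softmax (θ k) s) -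
      α / (1 - M.γ) * ∑ s, M.stateVisit p s * klVec (p s) (softmax (θ (k + 1)) s) +
      2 * (α / (1 - M.γ) * Real.log (Fintype.card A) / K) +
      (l1norm (gradV Φ (M.valueVec (softmax (θ' (k + 1)))) (lam' (k + 1)) -
        gradV Φ (M.valueVec (softmax (θ' k))) (lam' k)) *
        ‖M.valueVec (softmax (θ (k + 1))) - M.valueVec (softmax (θ' (k + 1)))‖ -
      3 * β * ‖M.valueVec (softmax (θ (k + 1))) - M.valueVec (softmax (θ' (k + 1)))‖ ^ 2 -
      3 * β * ‖M.valueVec (softmax (θ' (k + 1))) - M.valueVec (softmax (θ k))‖ ^ 2) := by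
  have hθ := hrun.step_policy k hk
  have hθ' := hrun.step_policy' k hk
  have hL1 := hL_bound (k + 1) hk
  have hL0 := hL_bound k hk.le
  have hy : IsPolicy (softmax (θ (k + 1))) := isPolicy_softmax _
  have hx : IsPolicy (softmax (θ' (k + 1))) := isPolicy_softmax _
  set g₁ := gradV Φ (M.valueVec (softmax (θ' (k + 1)))) (lam' (k + 1))
  set g₀ := gradV Φ (M.valueVec (softmax (θ' k))) (lam' k)
  -- Both updates share the anchor `θ k`. The final one is compared with `p`, the predictor with the
  -- final policy; in the sum the divergence of the final policy from the anchor cancels.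
  have h1 := M.three_point_dirReward (θ₀ := θ k) hβ hα hL hL1 hK (ht k) hp
  have h2 := M.three_point_dirReward (θ₀ := θ k) hβ hα hL hL0 hK (ht k) hy
  rw [← hη, ← hθ, MOMDP.anchoredValue_dirReward hp, MOMDP.anchoredValue_dirReward hy] at h1
  rw [← hη, ← hθ', MOMDP.anchoredValue_dirReward hy, MOMDP.anchoredValue_dirReward hx] at h2
  have h3 := MOMDP.valueVec_sq_le_kl (M := M) hα hy hβ (θ' (k + 1))
  have h4 := MOMDP.valueVec_sq_le_kl (M := M) hα hx hβ (θ k)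
  have h5 := dotProduct_le_l1norm_mul_norm (g₁ - g₀)
    (M.valueVec (softmax (θ (k + 1))) - M.valueVec (softmax (θ' (k + 1))))
  simp only [sub_dotProduct, dotProduct_sub] at h5 ⊢
  linarith

/-- The regret of the two mirror descent updates of one macro step. -/
theorem lam_step (hrun : IsOMDARun M Φ Λ α η η' K t θ θ' lam lam') (hβ : 0 < β)
    (hη'_pos : 0 < η') (hη' : η' ≤ 1 / (6 * β)) (hΛ : Λ ⊆ stdSimplex ℝ (Fin m))
    (hconv : Convex ℝ Λ) (hm : Nonempty (Fin m)) {μ : Fin m → ℝ} (hμ : μ ∈ Λ)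
    {k : ℕ} (hk : k < K) :
    gradLam Φ (M.valueVec (softmax (θ' (k + 1)))) (lam' (k + 1)) ⬝ᵥ (lam' (k + 1) - μ) ≤
      klVec μ (lam k) / η' - klVec μ (lam (k + 1)) / η' +
      (‖gradLam Φ (M.valueVec (softmax (θ' (k + 1)))) (lam' (k + 1)) -
        gradLam Φ (M.valueVec (softmax (θ' k))) (lam' k)‖ *
        l1norm (lam (k + 1) - lam' (k + 1)) -
      3 * β * l1norm (lam (k + 1) - lam' (k + 1)) ^ 2 -
      3 * β * l1norm (lam' (k + 1) - lam k) ^ 2) := by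
  have hs := hrun.step_lam k hk
  have hs' := hrun.step_lam' k hk
  have hlk := hrun.lam_mem hΛ hm hk.le
  have hdom := hrun.domBy_lam hη'_pos hΛ hconv hm hμ hk.le
  have h1 := hs.three_point hη'_pos hΛ hconv hlk.1 hμ hdom
  have h2 := hs'.three_point hη'_pos hΛ hconv hlk.1 hs.mem hs.domBy
  have hd2 := hs'.domBy_of_mem hη'_pos hΛ hconv hlk.1 hs.mem hs.domBy
  have h3 := sq_l1norm_sub_le (hΛ hs.mem) (hΛ hs'.mem) hd2
  have h4 := sq_l1norm_sub_le (hΛ hs'.mem) hlk hs'.domBy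
  have hkl1 := klVec_nonneg (hΛ hs.mem) (hΛ hs'.mem) hd2
  have hkl2 := klVec_nonneg (hΛ hs'.mem) hlk hs'.domBy
  have hscale : ∀ x d : ℝ, 0 ≤ d → x ≤ 2 * d → 3 * β * x ≤ d / η' := by
    intro x d hd hx
    have h6 : 6 * β * η' ≤ 1 := by
      rw [le_div_iff₀ (by positivity)] at hη'
      linarith
    rw [le_div_iff₀ hη'_pos]
    calc 3 * β * x * η' ≤ 3 * β * (2 * d) * η' := by gcongr
      _ = (6 * β * η') * d := by ring
      _ ≤ 1 * d := by gcongr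
      _ = d := one_mul d
  have h5 := hscale _ _ hkl1 h3
  have h6 := hscale _ _ hkl2 h4
  set h₁ := gradLam Φ (M.valueVec (softmax (θ' (k + 1)))) (lam' (k + 1))
  set h₀ := gradLam Φ (M.valueVec (softmax (θ' k))) (lam' k)
  have h7 := dotProduct_le_norm_mul_l1norm (h₁ - h₀) (lam' (k + 1) - lam (k + 1))
  rw [l1norm_sub_comm] at h7
  simp only [sub_dotProduct, dotProduct_sub] at h7 ⊢
  linarith

/-- The total regret of the run against a fixed policy and a fixed `μ ∈ Λ`. -/
theorem regret_le (hrun : IsOMDARun M Φ Λ α η η' K t θ θ' lam lam')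
    (hΛ : Λ ⊆ stdSimplex ℝ (Fin m)) (hconv : Convex ℝ Λ) (hm : Nonempty (Fin m))
    (hβ : 0 < β) (hΦ_smooth : IsSmoothOn Φ M.valueSet β) (hK : 1 ≤ K)
    (hη'_pos : 0 < η') (hη' : η' ≤ 1 / (6 * β))
    (hα : 6 * β / (1 - M.γ) ^ 3 ≤ α) (hη : η = (1 - M.γ) / α) (hL : 0 < L)
    (hL_bound : ∀ k ≤ K, l1norm (gradV Φ (M.valueVec (softmax (θ' k))) (lam' k)) ≤ L)
    (ht : ∀ k, t k = ⌈1 / (1 - M.γ) *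
      Real.log (5 * L * K / (6 * β * Real.log (Fintype.card A))) + 1⌉₊)
    {p : S → A → ℝ} (hp : IsPolicy p) {μ : Fin m → ℝ} (hμ : μ ∈ Λ) :
    ∑ k ∈ Finset.range K,
      (gradV Φ (M.valueVec (softmax (θ' (k + 1)))) (lam' (k + 1)) ⬝ᵥ
          (M.valueVec p - M.valueVec (softmax (θ' (k + 1)))) +
        gradLam Φ (M.valueVec (softmax (θ' (k + 1)))) (lam' (k + 1)) ⬝ᵥ (lam' (k + 1) - μ)) ≤
      3 * (α / (1 - M.γ) * Real.log (Fintype.card A)) + Real.log m / η' := by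
  have hγ := M.one_sub_γ_pos
  have hα0 : 0 < α := lt_of_lt_of_le (by positivity) hα
  -- The potential: divergences of the comparators from the iterates, plus the squared distances
  -- between iterate and predictor left over by `optimistic_step_le`.
  set Ψ : ℕ → ℝ := fun k =>
    α / (1 - M.γ) * ∑ s, M.stateVisit p s * klVec (p s) (softmax (θ k) s) +
    klVec μ (lam k) / η' +
    2 * β * (‖M.valueVec (softmax (θ k)) - M.valueVec (softmax (θ' k))‖ ^ 2 +
      l1norm (lam k - lam' k) ^ 2) with hΨ
  set e := α / (1 - M.γ) * Real.log (Fintype.card A) / K with he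
  have hstep : ∀ k ∈ Finset.range K,
      gradV Φ (M.valueVec (softmax (θ' (k + 1)))) (lam' (k + 1)) ⬝ᵥ
          (M.valueVec p - M.valueVec (softmax (θ' (k + 1)))) +
        gradLam Φ (M.valueVec (softmax (θ' (k + 1)))) (lam' (k + 1)) ⬝ᵥ (lam' (k + 1) - μ) ≤
      (Ψ k - Ψ (k + 1)) + 2 * e := by
    intro k hk
    replace hk := Finset.mem_range.1 hk
    have h1 := hrun.policy_step hβ hα hη hL hK hL_bound ht hp hk
    have h2 := hrun.lam_step hβ hη'_pos hη' hΛ hconv hm hμ hk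
    have hlip := hΦ_smooth.lipschitz (M.valueVec (softmax (θ' (k + 1))))
      ⟨_, isPolicy_softmax _, rfl⟩ (lam' (k + 1)) (hrun.lam'_mem hΛ hm hk)
      (M.valueVec (softmax (θ' k))) ⟨_, isPolicy_softmax _, rfl⟩ (lam' k)
      (hrun.lam'_mem hΛ hm hk.le)
    have h3 := optimistic_step_le hβ.le (l1norm_nonneg _) (norm_nonneg _)
      (norm_nonneg (M.valueVec (softmax (θ (k + 1))) - M.valueVec (softmax (θ' (k + 1)))))
      (l1norm_nonneg (lam (k + 1) - lam' (k + 1))) hlip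
      (norm_sub_le_norm_sub_add_norm_sub _ (M.valueVec (softmax (θ k))) _)
      (l1norm_sub_le _ (lam k) _)
    simp only [hΨ]
    linarith
  refine (Finset.sum_le_sum hstep).trans ?_
  rw [Finset.sum_add_distrib, Finset.sum_range_sub', Finset.sum_const, Finset.card_range,
    nsmul_eq_mul]
  have hKne : (K : ℝ) ≠ 0 := by positivity
  have e1 : (K : ℝ) * (2 * e) = 2 * (α / (1 - M.γ) * Real.log (Fintype.card A)) := by
    rw [he]; field_simp
  have hK0 : 0 ≤ Ψ K := by
    have i1 : 0 ≤ ∑ s, M.stateVisit p s * klVec (p s) (softmax (θ K) s) :=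
      Finset.sum_nonneg fun s _ =>
        mul_nonneg (M.stateVisit_nonneg hp s) (MOMDP.klVec_softmax_nonneg hp _ s)
    have i2 := klVec_nonneg (hΛ hμ) (hrun.lam_mem hΛ hm le_rfl)
      (hrun.domBy_lam hη'_pos hΛ hconv hm hμ le_rfl)
    simp only [hΨ]
    positivity
  have h0 : Ψ 0 ≤ α / (1 - M.γ) * Real.log (Fintype.card A) + Real.log m / η' := by
    have i1 : ∑ s, M.stateVisit p s * klVec (p s) (softmax (θ 0) s) ≤
        Real.log (Fintype.card A) := by
      calc _ ≤ ∑ s, M.stateVisit p s * Real.log (Fintype.card A) := by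
            refine Finset.sum_le_sum fun s _ =>
              mul_le_mul_of_nonneg_left ?_ (M.stateVisit_nonneg hp s)
            rw [show softmax (θ 0) s = fun _ => 1 / (Fintype.card A : ℝ) from
              funext (hrun.init_uniform s)]
            exact klVec_uniform_le (hp s)
        _ = _ := by rw [← Finset.sum_mul, (M.stateVisit_mem hp).2, one_mul]
    have i2 : klVec μ (lam 0) ≤ Real.log m := by
      rw [hrun.init_lam]
      simpa using klVec_uniform_le (hΛ hμ)
    -- Iterate and predictor coincide at the start, so only the divergences from uniform remain.
    simp only [hΨ, hrun.init_policy, hrun.init_lam, hrun.init_lam', sub_self]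
    rw [hrun.init_lam] at i2
    have i3 : l1norm (0 : Fin m → ℝ) = 0 := by simp [l1norm]
    rw [i3, norm_zero, zero_pow two_ne_zero, add_zero, mul_zero, add_zero]
    gcongr
  rw [e1]
  linarith

end IsOMDARun

end Run

/-! ### From regret to the max-min gap -/

theorem theorem3 {S A : Type*} [Fintype S] [Fintype A] [DecidableEq S] [DecidableEq A]
    [Nonempty A] {m : ℕ} (M : MOMDP S A m)
    (Φ : (Fin m → ℝ) → (Fin m → ℝ) → ℝ) (Λ : Set (Fin m → ℝ)) (β L α η η' : ℝ) (K : ℕ)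
    (t : ℕ → ℕ) (θ θ' : ℕ → S × A → ℝ) (lam lam' : ℕ → Fin m → ℝ)
    (hΛ_sub : Λ ⊆ stdSimplex ℝ (Fin m)) (hΛ_ne : Λ.Nonempty) (hΛ_conv : Convex ℝ Λ)
    (hΛ_closed : IsClosed Λ)
    (hΦ_concave : ∀ μ ∈ Λ, ConcaveOn ℝ (convexHull ℝ M.valueSet) (fun v => Φ v μ))
    (hΦ_convex : ∀ v ∈ M.valueSet, ConvexOn ℝ Λ (fun μ => Φ v μ))
    (hβ : 0 < β) (hΦ_smooth : IsSmoothOn Φ M.valueSet β)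
    (hK : 1 ≤ K)
    (hη'_pos : 0 < η') (hη' : η' ≤ 1 / (6 * β))
    (hα : 6 * β / (1 - M.γ) ^ 3 ≤ α) (hη : η = (1 - M.γ) / α)
    (hL : 0 < L)
    (hL_bound : ∀ k ≤ K, l1norm (gradV Φ (M.valueVec (softmax (θ' k))) (lam' k)) ≤ L)
    (ht : ∀ k, t k = ⌈1 / (1 - M.γ) *
      Real.log (5 * L * K / (6 * β * Real.log (Fintype.card A))) + 1⌉₊)
    (hrun : IsOMDARun M Φ Λ α η η' K t θ θ' lam lam')
    (πstar : S → A → ℝ) (hπstar : IsPolicy πstar) :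
    minValue Φ Λ (M.valueVec πstar) -
        minValue Φ Λ ((1 / (K : ℝ)) • ∑ k ∈ Finset.Icc 1 K, M.valueVec (softmax (θ' k))) ≤
      3 * α * Real.log (Fintype.card A) / ((1 - M.γ) * K) + Real.log m / (η' * K) := by
  obtain ⟨μ₀, hμ₀⟩ := hΛ_ne
  have hm : Nonempty (Fin m) := by
    by_contra h
    have := (hΛ_sub hμ₀).2
    rw [not_nonempty_iff] at h
    simp at this
  have hK0 : (0 : ℝ) < K := by exact_mod_cast hK
  set x : ℕ → Fin m → ℝ := fun k => M.valueVec (softmax (θ' k)) with hx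
  have hxV : ∀ k, x k ∈ M.valueSet := fun k => ⟨_, isPolicy_softmax _, rfl⟩
  have hxC : ∀ k, x k ∈ convexHull ℝ M.valueSet := fun k => subset_convexHull ℝ _ (hxV k)
  have hsV : M.valueVec πstar ∈ M.valueSet := ⟨_, hπstar, rfl⟩
  have hsum1 : ∑ _k ∈ Finset.range K, 1 / (K : ℝ) = 1 := by
    rw [Finset.sum_const, Finset.card_range, nsmul_eq_mul, mul_one_div_cancel hK0.ne']
  have hw : ∀ k ∈ Finset.range K, 0 ≤ 1 / (K : ℝ) := fun _ _ => by positivity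
  have hlamΛ : ∀ k ∈ Finset.range K, lam' (k + 1) ∈ Λ := fun k hk =>
    (hrun.step_lam' k (Finset.mem_range.1 hk)).mem
  have hIcc : ∑ k ∈ Finset.Icc 1 K, M.valueVec (softmax (θ' k)) =
      ∑ k ∈ Finset.range K, x (k + 1) := by
    rw [Finset.range_eq_Ico, Finset.sum_Ico_add' x 0 K 1]
    refine Finset.sum_congr ?_ fun _ _ => rfl
    ext k
    simp only [Finset.mem_Icc, Finset.mem_Ico]
    omega
  set xbar := ∑ k ∈ Finset.range K, (1 / (K : ℝ)) • x (k + 1)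
  set lbar := ∑ k ∈ Finset.range K, (1 / (K : ℝ)) • lam' (k + 1)
  rw [hIcc, Finset.smul_sum]
  have hlbar : lbar ∈ Λ := hΛ_conv.sum_mem hw hsum1 hlamΛ
  -- Boundedness is needed because `sInf` of a set unbounded below is 0 by convention; compactness
  -- of `Λ` supplies it.
  have hbdd : BddBelow (Φ (M.valueVec πstar) '' Λ) := by
    have hcomp : IsCompact Λ := (isCompact_stdSimplex ℝ (Fin m)).of_isClosed_subset hΛ_closed hΛ_sub
    refine hcomp.bddBelow_image fun μ hμ => ?_
    exact (hΦ_smooth.diff_right _ hsV μ (hΛ_sub hμ)).continuousAt.continuousWithinAt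
  have hF : minValue Φ Λ (M.valueVec πstar) ≤
      ∑ k ∈ Finset.range K, (1 / (K : ℝ)) * Φ (M.valueVec πstar) (lam' (k + 1)) :=
    (csInf_le hbdd ⟨lbar, hlbar, rfl⟩).trans
      ((hΦ_convex _ hsV).map_sum_le hw hsum1 hlamΛ)
  have hgap : minValue Φ Λ (M.valueVec πstar) -
      (3 * α * Real.log (Fintype.card A) / ((1 - M.γ) * K) + Real.log m / (η' * K)) ≤
      minValue Φ Λ xbar := by
    refine le_csInf ⟨_, μ₀, hμ₀, rfl⟩ ?_
    rintro _ ⟨μ, hμ, rfl⟩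
    have hreg := hrun.regret_le hΛ_sub hΛ_conv hm hβ hΦ_smooth hK hη'_pos hη' hα hη hL hL_bound ht
      hπstar hμ
    -- Here `xbar` enters only as a point of the convex hull: concavity is used there but no
    -- gradient, since linearisation takes place at the points `x (k + 1)`.
    have hxbar : ∑ k ∈ Finset.range K, (1 / (K : ℝ)) * Φ (x (k + 1)) μ ≤ Φ xbar μ :=
      (hΦ_concave μ hμ).le_map_sum hw hsum1 fun k _ => hxC (k + 1)
    have hlin : ∑ k ∈ Finset.range K, (1 / (K : ℝ)) * Φ (M.valueVec πstar) (lam' (k + 1)) -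
        ∑ k ∈ Finset.range K, (1 / (K : ℝ)) * Φ (x (k + 1)) μ ≤
        1 / (K : ℝ) * (3 * (α / (1 - M.γ) * Real.log (Fintype.card A)) + Real.log m / η') := by
      refine le_trans ?_ (mul_le_mul_of_nonneg_left hreg (by positivity))
      rw [← Finset.sum_sub_distrib, Finset.mul_sum]
      refine Finset.sum_le_sum fun k hk => ?_
      rw [← mul_sub]
      refine mul_le_mul_of_nonneg_left ?_ (by positivity)
      have hl := hlamΛ k hk
      -- Both linearisations are at the predictor pair. The values of `Φ` at that pair cancel in the
      -- sum, leaving the regret summand.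
      have i1 := (hΦ_concave _ hl).le_add_fderiv (hxC (k + 1)) (subset_convexHull ℝ _ hsV)
        (hΦ_smooth.diff_left _ (hxV (k + 1)) _ (hΛ_sub hl))
      have i2 := (hΦ_convex _ (hxV (k + 1))).add_fderiv_le hl hμ
        (hΦ_smooth.diff_right _ (hxV (k + 1)) _ (hΛ_sub hl))
      rw [← grad_dotProduct] at i1 i2
      have e : grad (fun μ => Φ (x (k + 1)) μ) (lam' (k + 1)) ⬝ᵥ (lam' (k + 1) - μ) =
          -(grad (fun μ => Φ (x (k + 1)) μ) (lam' (k + 1)) ⬝ᵥ (μ - lam' (k + 1))) := by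
        rw [← dotProduct_neg, neg_sub]
      simp only [gradV, gradLam]
      simp only [hx] at e i1 i2 ⊢
      rw [e]
      linarith
    have e2 : 1 / (K : ℝ) * (3 * (α / (1 - M.γ) * Real.log (Fintype.card A)) + Real.log m / η') =
        3 * α * Real.log (Fintype.card A) / ((1 - M.γ) * K) + Real.log m / (η' * K) := by
      have := M.one_sub_γ_pos
      field_simp
    rw [e2] at hlin
    linarith
  linarith
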